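/- A \emph{squares category} $\mathbb{A}$ is a flat double category (objects, horizontal morphisms $\rightarrowtail$, vertical morphisms $\twoheadrightarrow$, and squares, each square being determined by its boundary) with a distinguished object $O$ that is initial in the category of objects and horizontal morphisms and terminal in the category of objects and vertical morphisms. For $n\ge 0$, let $S^{\square}_n\mathbb{A}$ be the category whose objects are staircase diagrams in $\mathbb{A}$ of objects $C_{ij}$, $0\le i\le j\le n$, with $C_{ii}=O$ for all $i$, horizontal morphisms $C_{ij}\rightarrowtail C_{i,j+1}$, vertical morphisms $C_{ij}\twoheadrightarrow C_{i+1,j}$ (for $i+1\le j$), and all the elementary boundaries being squares of $\mathbb{A}$; that is, double functors to $\mathbb{A}$ from the flat double category generated by the staircase, with diagonal values $O$. Let $T^+_n\mathbb{A}$ be the category whose objects are such staircases together with an additional top row $C_0\rightarrowtail C_1\rightarrowtail\cdots\rightarrowtail C_n$ and vertical morphisms $C_j\twoheadrightarrow C_{0j}$ such that all the boundaries formed by $C_j, C_{j+1}, C_{0j}, C_{0,j+1}$ are squares of $\mathbb{A}$ (no condition on $C_0$). In both cases the morphisms are the vertical natural transformations: families of vertical morphisms between corresponding entries such that every boundary formed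 with two horizontal morphisms is a square of $\mathbb{A}$ and every boundary formed with vertical morphisms only commutes. These categories form simplicial categories $S^{\square}_\bullet\mathbb{A}$ and $T^+_\bullet\mathbb{A}$: the face $d_i$ removes the row and the column of index $i$ (composing where appropriate; the additional row of $T^+_n\mathbb{A}$ only loses its entry $C_i$), and degeneracies insert identities. The realization of a simplicial category is the geometric realization of the diagonal of the bisimplicial set obtained by taking nerves levelwise. \textbf{Proposition.} For every squares category $\mathbb{A}$, deleting the top row gives a map of simplicial categories $U\colon T^+_\bullet\mathbb{A}\to S^{\square}_\bullet\mathbb{A}$, and the induced map of realizations $|U|\colon |T^+_\bullet\mathbb{A}|\to|S^{\square}_\bullet\mathbb{A}|$ is a homotopy equivalence. Moreover, for every $n\ge 0$ let $F_n\colon S^{\square}_n\mathbb{A}\to T^+_n\mathbb{A}$ be the functor that adds a copy of the row $O=C_{00}\rightarrowtail C_{01}\rightarrowtail\cdots\rightarrowtail C_{0n}$ as the new top row, with identities as the vertical morphisms from it to the row of index $0$. Then $U_nF_n=\mathrm{id}$, and there is a natural transformation $\tau\colon \mathrm{id}\Rightarrow F_nU_n$ whose component at an object $X$ is given by the vertical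 morphisms $C_j\twoheadrightarrow C_{0j}$ of $X$ on the top row and by identities on the other entries. -/

import Mathlib

open CategoryTheory Opposite Simplicial

universe u v u₁ v₁ u₂ v₂ u₃ v₃

/-- A flat double category: objects, a category of horizontal morphisms and a category of vertical
morphisms on the same objects, and squares. As the double category is flat, a square is determined
by its boundary, so that squares are a predicate on boundaries, containing the horizontal and
vertical identity squares and closed under horizontal and vertical composition (the associativity,
unit and interchange laws for squares hold automatically). -/
structure FlatDoubleCategory where
  /-- the objects -/
  Obj : Type u
  /-- the underlying horizontal category -/
  hor : Category.{v} Obj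
  /-- the underlying vertical category -/
  ver : Category.{v} Obj
  /-- `IsSquare f a b g`: the boundary with top `f`, left side `a`, right side `b` and bottom `g`
  is a square. -/
  IsSquare : ∀ {A B A' B' : Obj}, hor.Hom A B → ver.Hom A A' → ver.Hom B B' → hor.Hom A' B' → Prop
  square_hor_id : ∀ {A A' : Obj} (a : ver.Hom A A'), IsSquare (hor.id A) a a (hor.id A')
  square_ver_id : ∀ {A B : Obj} (f : hor.Hom A B), IsSquare f (ver.id A) (ver.id B) f
  square_hor_comp : ∀ {A B D A' B' D' : Obj} {f : hor.Hom A B} {g : hor.Hom B D}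
    {a : ver.Hom A A'} {b : ver.Hom B B'} {d : ver.Hom D D'}
    {f' : hor.Hom A' B'} {g' : hor.Hom B' D'},
    IsSquare f a b f' → IsSquare g b d g' → IsSquare (hor.comp f g) a d (hor.comp f' g')
  square_ver_comp : ∀ {A B A' B' A'' B'' : Obj} {f : hor.Hom A B} {f' : hor.Hom A' B'}
    {f'' : hor.Hom A'' B''} {a : ver.Hom A A'} {b : ver.Hom B B'}
    {a' : ver.Hom A' A''} {b' : ver.Hom B' B''},
    IsSquare f a b f' → IsSquare f' a' b' f'' → IsSquare f (ver.comp a a') (ver.comp b b') f''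

/-- A squares category: a flat double category with a distinguished object `O` which is initial in
the horizontal category and terminal in the vertical category. -/
structure SquaresCategory extends FlatDoubleCategory.{u, v} where
  /-- the distinguished object -/
  O : Obj
  initial_hor : ∀ A : Obj, Nonempty (Unique (hor.Hom O A))
  terminal_ver : ∀ A : Obj, Nonempty (Unique (ver.Hom A O))

/-- Double functors between flat double categories. -/
structure DoubleFunctor (A : FlatDoubleCategory.{u₁, v₁}) (B : FlatDoubleCategory.{u₂, v₂}) where
  /-- the action on objects -/
  obj : A.Obj → B.Obj
  /-- the action on horizontal morphisms -/
  hmap : ∀ {X Y : A.Obj}, A.hor.Hom X Y → B.hor.Hom (obj X) (obj Y)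
  /-- the action on vertical morphisms -/
  vmap : ∀ {X Y : A.Obj}, A.ver.Hom X Y → B.ver.Hom (obj X) (obj Y)
  hmap_id : ∀ X : A.Obj, hmap (A.hor.id X) = B.hor.id (obj X)
  hmap_comp : ∀ {X Y Z : A.Obj} (f : A.hor.Hom X Y) (g : A.hor.Hom Y Z),
    hmap (A.hor.comp f g) = B.hor.comp (hmap f) (hmap g)
  vmap_id : ∀ X : A.Obj, vmap (A.ver.id X) = B.ver.id (obj X)
  vmap_comp : ∀ {X Y Z : A.Obj} (a : A.ver.Hom X Y) (b : A.ver.Hom Y Z),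
    vmap (A.ver.comp a b) = B.ver.comp (vmap a) (vmap b)
  map_square : ∀ {X Y X' Y' : A.Obj} {f : A.hor.Hom X Y} {a : A.ver.Hom X X'}
    {b : A.ver.Hom Y Y'} {g : A.hor.Hom X' Y'},
    A.IsSquare f a b g → B.IsSquare (hmap f) (vmap a) (vmap b) (hmap g)

namespace DoubleFunctor

variable {A : FlatDoubleCategory.{u₁, v₁}} {B : FlatDoubleCategory.{u₂, v₂}}
  {D : FlatDoubleCategory.{u₃, v₃}}

/-- Composition of double functors, in diagrammatic order. -/
def comp (F : DoubleFunctor A B) (G : DoubleFunctor B D) : DoubleFunctor A D where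
  obj X := G.obj (F.obj X)
  hmap f := G.hmap (F.hmap f)
  vmap a := G.vmap (F.vmap a)
  hmap_id X := by rw [F.hmap_id, G.hmap_id]
  hmap_comp f g := by rw [F.hmap_comp, G.hmap_comp]
  vmap_id X := by rw [F.vmap_id, G.vmap_id]
  vmap_comp a b := by rw [F.vmap_comp, G.vmap_comp]
  map_square h := G.map_square (F.map_square h)

/-- Vertical natural transformations between double functors of flat double categories. -/
@[ext]
structure VertTrans (F G : DoubleFunctor A B) where
  /-- the components -/
  app : ∀ X : A.Obj, B.ver.Hom (F.obj X) (G.obj X)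
  square : ∀ {X Y : A.Obj} (f : A.hor.Hom X Y),
    B.IsSquare (F.hmap f) (app X) (app Y) (G.hmap f)
  naturality : ∀ {X Y : A.Obj} (a : A.ver.Hom X Y),
    B.ver.comp (F.vmap a) (app Y) = B.ver.comp (app X) (G.vmap a)

/-- The category of double functors from `A` to `B` and vertical natural transformations. -/
instance category : Category (DoubleFunctor A B) where
  Hom F G := VertTrans F G
  id F :=
    { app := fun X => B.ver.id (F.obj X)
      square := fun f => B.square_ver_id (F.hmap f)
      naturality := fun a => by rw [B.ver.comp_id, B.ver.id_comp] }
  comp s t :=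
    { app := fun X => B.ver.comp (s.app X) (t.app X)
      square := fun f => B.square_ver_comp (s.square f) (t.square f)
      naturality := fun a => by
        rw [← B.ver.assoc, s.naturality, B.ver.assoc, t.naturality, B.ver.assoc] }
  id_comp s := VertTrans.ext (funext fun _ => B.ver.id_comp _)
  comp_id s := VertTrans.ext (funext fun _ => B.ver.comp_id _)
  assoc s t w := VertTrans.ext (funext fun _ => B.ver.assoc _ _ _)

/-- Precomposition with a double functor, as a functor between the categories of double functors
and vertical natural transformations. -/
def precomp (F : DoubleFunctor A B) (D : FlatDoubleCategory.{u₃, v₃}) :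
    DoubleFunctor B D ⥤ DoubleFunctor A D where
  obj G := F.comp G
  map s :=
    { app := fun X => s.app (F.obj X)
      square := fun f => s.square (F.hmap f)
      naturality := fun a => s.naturality (F.vmap a) }

end DoubleFunctor

/-- The staircase-shaped grid with rows indexed by `R`, columns indexed by `J`, whose positions are
the pairs `(r, j)` with `r ≤ d j`. Horizontal morphisms move to the right within a row,
vertical morphisms move downwards (that is, to larger row indices) within a column, there is at
most one morphism of each kind between two positions, and every boundary is a square. -/
def gridShape (R J : Type) [PartialOrder R] [PartialOrder J] (d : J → R) :
    FlatDoubleCategory.{0, 0} where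
  Obj := {p : R × J // p.1 ≤ d p.2}
  hor :=
    { Hom := fun p q => PLift (p.1.1 = q.1.1 ∧ p.1.2 ≤ q.1.2)
      id := fun _ => ⟨rfl, le_rfl⟩
      comp := fun f g => ⟨f.down.1.trans g.down.1, f.down.2.trans g.down.2⟩ }
  ver :=
    { Hom := fun p q => PLift (p.1.1 ≤ q.1.1 ∧ p.1.2 = q.1.2)
      id := fun _ => ⟨le_rfl, rfl⟩
      comp := fun a b => ⟨a.down.1.trans b.down.1, a.down.2.trans b.down.2⟩ }
  IsSquare _ _ _ _ := True
  square_hor_id _ := trivial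
  square_ver_id _ := trivial
  square_hor_comp _ _ := trivial
  square_ver_comp _ _ := trivial

/-- The double functor between grids given by monotone maps `r` on rows and `c` on columns. -/
def gridMap {R J R' J' : Type} [PartialOrder R] [PartialOrder J] [PartialOrder R'] [PartialOrder J']
    {d : J → R} {d' : J' → R'} (r : R →o R') (c : J →o J') (h : ∀ j, r (d j) ≤ d' (c j)) :
    DoubleFunctor (gridShape R J d) (gridShape R' J' d') where
  obj p := ⟨(r p.1.1, c p.1.2), (r.monotone p.2).trans (h p.1.2)⟩
  hmap f := ⟨congrArg r f.down.1, c.monotone f.down.2⟩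
  vmap a := ⟨r.monotone a.down.1, congrArg c a.down.2⟩
  hmap_id _ := rfl
  hmap_comp _ _ := rfl
  vmap_id _ := rfl
  vmap_comp _ _ := rfl
  map_square _ := trivial

/-- The double category of shape
`A₀₀ ↣ A₀₁ ↣ ⋯ ↣ A₀ₙ`, `A₁₁ ↣ ⋯ ↣ A₁ₙ`, …, `Aₙₙ`, with positions `(i, j)`, `0 ≤ i ≤ j ≤ n`. -/
abbrev sShape (n : ℕ) : FlatDoubleCategory.{0, 0} :=
  gridShape (Fin (n + 1)) (Fin (n + 1)) id

/-- The shape of the objects of `T⁺ₙ`: the staircase `sShape n` with an additional top row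
`C₀ ↣ ⋯ ↣ Cₙ` above it. The additional row has index `⊥`, so that `(⊥, j)` is the position of
`C_j` and `(i, j)` with `i ≤ j` that of `C_{ij}`. -/
abbrev tPlusShape (n : ℕ) : FlatDoubleCategory.{0, 0} :=
  gridShape (WithBot (Fin (n + 1))) (Fin (n + 1)) (fun j => (j : WithBot (Fin (n + 1))))

/-- The map of shapes `sShape m → sShape n`, `(i, j) ↦ (θ i, θ j)`. -/
def sShapeMap {m n : ℕ} (θ : Fin (m + 1) →o Fin (n + 1)) :
    DoubleFunctor (sShape m) (sShape n) :=
  gridMap θ θ (fun _ => le_rfl)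

lemma gridMap_congr {R J R' J' : Type} [PartialOrder R] [PartialOrder J] [PartialOrder R']
    [PartialOrder J'] {d : J → R} {d' : J' → R'} {r r' : R →o R'} {c : J →o J'}
    (h : ∀ j, r (d j) ≤ d' (c j)) (hr : r = r') :
    gridMap r c h = gridMap (d := d) (d' := d') r' c (fun j => hr ▸ h j) := by
  subst hr; rfl

/-- The map of shapes `tPlusShape m → tPlusShape n`, `(i, j) ↦ (θ i, θ j)`, `(⊥, j) ↦ (⊥, θ j)`. -/
def tPlusShapeMap {m n : ℕ} (θ : Fin (m + 1) →o Fin (n + 1)) :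
    DoubleFunctor (tPlusShape m) (tPlusShape n) :=
  gridMap θ.withBotMap θ (fun _ => le_rfl)

lemma tPlusShapeMap_id (n : ℕ) :
    tPlusShapeMap (OrderHom.id : Fin (n + 1) →o Fin (n + 1)) =
      gridMap (d := fun j : Fin (n + 1) => (j : WithBot (Fin (n + 1))))
        (d' := fun j : Fin (n + 1) => (j : WithBot (Fin (n + 1))))
        OrderHom.id OrderHom.id (fun _ => le_rfl) :=
  gridMap_congr _ (by ext x; cases x <;> rfl)

lemma tPlusShapeMap_comp {l m n : ℕ} (θ : Fin (l + 1) →o Fin (m + 1))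
    (η : Fin (m + 1) →o Fin (n + 1)) :
    tPlusShapeMap (η.comp θ) = (tPlusShapeMap θ).comp (tPlusShapeMap η) :=
  gridMap_congr (r' := η.withBotMap.comp θ.withBotMap) _ (by ext x; cases x <;> rfl)

/-- The inclusion of the staircase as the part below the top row. -/
def shapeIncl (n : ℕ) : DoubleFunctor (sShape n) (tPlusShape n) :=
  gridMap ⟨fun i => (i : WithBot (Fin (n + 1))), WithBot.coe_mono⟩ OrderHom.id (fun _ => le_rfl)

/-- The collapse of the top row onto the row `0`. -/
def shapeCollapse (n : ℕ) : DoubleFunctor (tPlusShape n) (sShape n) :=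
  gridMap ⟨fun i => i.unbotD 0, fun a b h => by
      cases a with
      | bot => exact Fin.zero_le _
      | coe a =>
        cases b with
        | bot => exact absurd h (WithBot.not_coe_le_bot a)
        | coe b => exact WithBot.coe_le_coe.1 h⟩
    OrderHom.id (fun _ => le_rfl)

/-- The vertical morphism of `tPlusShape n` from a position to its image in row `0` if it lies in
the top row, and to itself otherwise. -/
def collapseHom {n : ℕ} (p : (tPlusShape n).Obj) :
    (tPlusShape n).ver.Hom p ((shapeIncl n).obj ((shapeCollapse n).obj p)) :=
  ⟨by
    obtain ⟨⟨i, j⟩, h⟩ := p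
    cases i with
    | bot => exact bot_le
    | coe i => exact le_rfl, rfl⟩

namespace SquaresCategory

variable (C : SquaresCategory.{u, v})

/-- The double functors `F : sShape n → C` with `F(A_{ii}) = O` for all `i`. -/
def sProp (n : ℕ) : ObjectProperty (DoubleFunctor (sShape n) C.toFlatDoubleCategory) :=
  fun F => ∀ i : Fin (n + 1), F.obj ⟨(i, i), le_rfl⟩ = C.O

/-- The double functors `F : tPlusShape n → C` with `F(i, i) = O` for all `i`. -/
def tPlusProp (n : ℕ) : ObjectProperty (DoubleFunctor (tPlusShape n) C.toFlatDoubleCategory) :=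
  fun F => ∀ i : Fin (n + 1), F.obj ⟨((i : WithBot (Fin (n + 1))), i), le_rfl⟩ = C.O

/-- The category `Sₙ C`. -/
abbrev SCat (n : ℕ) : Type (max u v) := (C.sProp n).FullSubcategory

/-- The category `T⁺ₙ C`. -/
abbrev TPlusCat (n : ℕ) : Type (max u v) := (C.tPlusProp n).FullSubcategory

/-- The simplicial structure maps of `S• C`. -/
def sMap {m n : ℕ} (θ : Fin (m + 1) →o Fin (n + 1)) : C.SCat n ⥤ C.SCat m :=
  (C.sProp m).lift ((C.sProp n).ι ⋙ (sShapeMap θ).precomp C.toFlatDoubleCategory)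
    (fun X i => X.property (θ i))

/-- The simplicial structure maps of `T⁺• C`. -/
def tPlusMap {m n : ℕ} (θ : Fin (m + 1) →o Fin (n + 1)) : C.TPlusCat n ⥤ C.TPlusCat m :=
  (C.tPlusProp m).lift ((C.tPlusProp n).ι ⋙ (tPlusShapeMap θ).precomp C.toFlatDoubleCategory)
    (fun X i => X.property (θ i))

lemma tPlusMap_eq {m n : ℕ} (θ : Fin (m + 1) →o Fin (n + 1))
    (K : DoubleFunctor (tPlusShape m) (tPlusShape n)) (hK : tPlusShapeMap θ = K) :
    C.tPlusMap θ = (C.tPlusProp m).lift ((C.tPlusProp n).ι ⋙ K.precomp C.toFlatDoubleCategory)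
      (fun X i => hK ▸ X.property (θ i)) := by
  subst hK; rfl

lemma tPlusMap_id (n : ℕ) : C.tPlusMap (OrderHom.id : Fin (n + 1) →o Fin (n + 1)) = 𝟭 _ :=
  (C.tPlusMap_eq _ _ (tPlusShapeMap_id n)).trans rfl

lemma tPlusMap_comp {l m n : ℕ} (θ : Fin (l + 1) →o Fin (m + 1))
    (η : Fin (m + 1) →o Fin (n + 1)) :
    C.tPlusMap (η.comp θ) = C.tPlusMap η ⋙ C.tPlusMap θ :=
  (C.tPlusMap_eq _ _ (tPlusShapeMap_comp θ η)).trans rfl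

/-- The simplicial category `S• C`. -/
def S : SimplexCategoryᵒᵖ ⥤ Cat.{v, max u v} where
  obj Δ := Cat.of (C.SCat Δ.unop.len)
  map f := (C.sMap f.unop.toOrderHom).toCatHom
  map_id _ := rfl
  map_comp _ _ := rfl

/-- The simplicial category `T⁺• C`. -/
def TPlus : SimplexCategoryᵒᵖ ⥤ Cat.{v, max u v} where
  obj Δ := Cat.of (C.TPlusCat Δ.unop.len)
  map f := (C.tPlusMap f.unop.toOrderHom).toCatHom
  map_id _ := Cat.ext (C.tPlusMap_id _)
  map_comp _ _ := Cat.ext (C.tPlusMap_comp _ _)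

/-- The functor `Uₙ : T⁺ₙ C ⥤ Sₙ C` deleting the top row. -/
def U (n : ℕ) : C.TPlusCat n ⥤ C.SCat n :=
  (C.sProp n).lift ((C.tPlusProp n).ι ⋙ (shapeIncl n).precomp C.toFlatDoubleCategory)
    (fun X i => X.property i)

/-- The simplicial map `T⁺• C ⟶ S• C` deleting the top row. -/
def forgetTopRow : C.TPlus ⟶ C.S where
  app Δ := (C.U Δ.unop.len).toCatHom
  naturality _ _ _ := rfl

/-- The functor `Fₙ : Sₙ C ⥤ T⁺ₙ C` adding a copy of the row `0` as a new top row, the vertical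
morphisms from the new row to the row `0` being identities. -/
def F (n : ℕ) : C.SCat n ⥤ C.TPlusCat n :=
  (C.tPlusProp n).lift ((C.sProp n).ι ⋙ (shapeCollapse n).precomp C.toFlatDoubleCategory)
    (fun X i => X.property i)

end SquaresCategory

/-- The geometric realization of simplicial categories: the levelwise nerve is a bisimplicial set,
and the realization is the geometric realization of its diagonal. -/
noncomputable def simplicialCatRealization :
    (SimplexCategoryᵒᵖ ⥤ Cat.{v, u}) ⥤ TopCat.{max u v} :=
  (Functor.whiskeringRight _ _ _).obj nerveFunctor.{v, u} ⋙ Functor.uncurry ⋙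
    (Functor.whiskeringLeft _ _ _).obj (Functor.diag SimplexCategoryᵒᵖ) ⋙ SSet.toTop.{max u v}

/-! `F n` and the transformation to it commute with simplicial operators fixing `0`, in particular
with all degeneracies. They do not commute with the face removing index `0`, since the copied top
row is then not the new row `0`. So they do not give a simplicial homotopy inverse of `U`, and the
proof shows that compatibility with degeneracies is enough.

The map `U` is factored through its levelwise collage, the simplicial category made of `T⁺` and `S`
with the morphisms `U t ⟶ s` added from `t` to `s`. Then `U` is `inl` followed by `proj`, and `proj`
is a left inverse of `inr`. Both `inl` and `inr` are levelwise full inclusions: `inr` is reflective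
through the universal morphisms `t ⟶ U t`, and `inl` has a deformation onto it built from `F` and
`τ`. It remains to show that such inclusions realize to homotopy equivalences
(`isHomotopyEquiv_simplicialCatRealization_map`).

For this, the diagonal of a bisimplicial set is filtered by columns. Stage `N` attaches the
pushout-product of `∂Δ[N] → Δ[N]` with the inclusion into column `N` of the subobject and the
horizontally degenerate simplices. That inclusion is anodyne as soon as the columnwise deformation
preserves degenerate simplices, so faces never enter (`anodyneExtensions_diagonal_ι_of_homotopy`).
Anodyne extensions realize to homotopy equivalences because they lift against singular complexes of
spaces and of path fibrations; both facts rest on explicit retractions onto horns. -/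

/-! ### Gluing, and a horn-filling criterion for maps of singular simplicial sets. -/

/-- Continuous maps on the members of a finite closed cover which agree on the overlaps glue. -/
lemma exists_continuousMap_of_closed_cover {X Y ι : Type*} [TopologicalSpace X]
    [TopologicalSpace Y] [Finite ι] (c : ι → Set X) (hc : ∀ i, IsClosed (c i))
    (hcov : ∀ x, ∃ i, x ∈ c i) (f : ι → C(X, Y))
    (hf : ∀ i j x, x ∈ c i → x ∈ c j → f i x = f j x) :
    ∃ g : C(X, Y), ∀ i x, x ∈ c i → g x = f i x := by
  choose k hk using hcov
  have key : ∀ i x, x ∈ c i → f (k x) x = f i x := fun i x hx => hf _ _ _ (hk x) hx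
  refine ⟨⟨fun x => f (k x) x, ?_⟩, key⟩
  refine (locallyFinite_of_finite c).continuous (Set.eq_univ_of_forall fun x =>
    Set.mem_iUnion.2 ⟨k x, hk x⟩) hc fun i => ?_
  exact (f i).continuous.continuousOn.congr fun x hx => key i x hx

section Simplex

variable {n : ℕ}

/-- A monotone retraction of `Fin (n + 1)` onto a nonempty subset. -/
lemma exists_monotone_retraction (S : Set (Fin (n + 1))) (hS : S.Nonempty) :
    ∃ e : Fin (n + 1) →o Fin (n + 1), (∀ x, e x ∈ S) ∧ ∀ x ∈ S, e x = x := by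
  classical
  let T : Fin (n + 1) → Finset (Fin (n + 1)) := fun x => Finset.univ.filter fun s => s ∈ S ∧ s ≤ x
  let m : Fin (n + 1) := (S.toFinset).min' (by simpa using hS)
  have hm : m ∈ S := by simpa using Finset.min'_mem S.toFinset (by simpa using hS)
  have hm' : ∀ s ∈ S, m ≤ s := fun s hs => Finset.min'_le _ _ (by simpa using hs)
  have hne : ∀ x, (insert m (T x)).Nonempty := fun x => ⟨m, by simp⟩
  -- Send `x` to the largest element of `S` below or equal to it; `m` is the default when there is
  -- none.
  refine ⟨⟨fun x => (insert m (T x)).max' (hne x), fun x y hxy => ?_⟩, fun x => ?_, fun x hx => ?_⟩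
  · refine Finset.max'_subset (hne x) (Finset.insert_subset_insert _ fun s hs => ?_)
    simp only [T, Finset.mem_filter, Finset.mem_univ, true_and] at hs ⊢
    exact ⟨hs.1, hs.2.trans hxy⟩
  · have := Finset.max'_mem _ (hne x)
    simp only [T, Finset.mem_insert, Finset.mem_filter, Finset.mem_univ, true_and] at this
    rcases this with h | h
    · exact Set.mem_of_eq_of_mem h hm
    · exact h.1
  · refine le_antisymm (Finset.max'_le _ (hne x) _ fun y hy => ?_) (Finset.le_max' (insert m (T x)) _ ?_)
    · simp only [T, Finset.mem_insert, Finset.mem_filter, Finset.mem_univ, true_and] at hy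
      rcases hy with rfl | h
      · exact hm' _ hx
      · exact h.2
    · simp [T, hx]

lemma stdSimplex.map_eq_self {X : Type*} [Fintype X] (e : X → X) (y : stdSimplex ℝ X)
    (h : ∀ x, y x ≠ 0 → e x = x) : stdSimplex.map e y = y := by
  classical
  ext x
  rw [stdSimplex.map_coe, FunOnFinite.linearMap_apply_apply]
  by_cases hx : y x = 0
  · rw [hx]
    refine Finset.sum_eq_zero fun z hz => ?_
    by_contra hz0
    simp only [Finset.mem_filter, Finset.mem_univ, true_and] at hz
    rw [h z hz0] at hz
    exact hz0 (hz ▸ hx)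
  · refine (Finset.sum_eq_single x (fun z hz hzx => ?_) fun hx' => ?_)
    · by_contra hz0
      simp only [Finset.mem_filter, Finset.mem_univ, true_and] at hz
      exact hzx (by rw [← h z hz0, hz])
    · simp [h x hx] at hx'

lemma stdSimplex.map_apply_eq_zero {X Y : Type*} [Fintype X] [Fintype Y] (e : X → Y)
    (y : stdSimplex ℝ X) (j : Y) (h : ∀ x, e x ≠ j) : stdSimplex.map e y j = 0 := by
  classical
  rw [stdSimplex.map_coe, FunOnFinite.linearMap_apply_apply]
  exact Finset.sum_eq_zero fun z hz => absurd (by simpa using hz) (h z)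

end Simplex

open SSet modelCategoryQuillen HomotopicalAlgebra in
/-- A continuous map induces a Kan fibration on singular simplicial sets as soon as it has the
lifting property for maps defined on horns by families of maps agreeing on the overlaps. -/
theorem TopCat.toSSet_map_mem_J_rlp {E B : TopCat.{u}} (p : E ⟶ B)
    (h : ∀ (n : ℕ) (i : Fin (n + 2)) (c : Fin (n + 2) → C(stdSimplex ℝ (Fin (n + 2)), E))
      (b : C(stdSimplex ℝ (Fin (n + 2)), B)),
      (∀ j k y, j ≠ i → k ≠ i → y j = 0 → y k = 0 → c j y = c k y) →
      (∀ j y, j ≠ i → y j = 0 → p (c j y) = b y) →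
      ∃ G : C(stdSimplex ℝ (Fin (n + 2)), E),
        (∀ j y, j ≠ i → y j = 0 → G y = c j y) ∧ ∀ y, p (G y) = b y) :
    J.rlp (TopCat.toSSet.map p) := by
  intro _ _ _ hJ
  simp only [J, MorphismProperty.iSup_iff] at hJ
  obtain ⟨n, ⟨i⟩⟩ := hJ
  refine ⟨fun {f g} sq => ?_⟩
  -- simplices of the horn are monotone maps missing a vertex other than `i`
  have mem : ∀ {m : ℕ} (σ : Fin (m + 1) →o Fin (n + 2)) (j : Fin (n + 2)), j ≠ i →
      (∀ x, σ x ≠ j) → (stdSimplex.objMk (n := ⦋n + 1⦌) (m := op ⦋m⦌) σ) ∈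
        (SSet.horn.{u} (n + 1) i).obj (op ⦋m⦌) := by
    intro m σ j hj hσ
    rw [mem_horn_iff_notMem_range]
    exact ⟨j, hj, by rintro ⟨x, hx⟩; exact hσ x hx⟩
  let F : ∀ {m : ℕ} (σ : Fin (m + 1) →o Fin (n + 2)) (j : Fin (n + 2)), j ≠ i →
      (∀ x, σ x ≠ j) → C(stdSimplex ℝ (Fin (m + 1)), E) := fun σ j hj hσ =>
    E.toSSetObjEquiv (op ⦋_⦌) (f.app (op ⦋_⦌) ⟨_, mem σ j hj hσ⟩)
  have F_comp : ∀ {m l : ℕ} (σ : Fin (m + 1) →o Fin (n + 2)) (θ : Fin (l + 1) →o Fin (m + 1))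
      (j : Fin (n + 2)) (hj : j ≠ i) (hσ : ∀ x, σ x ≠ j) (y : stdSimplex ℝ (Fin (l + 1))),
      F (σ.comp θ) j hj (fun x => hσ _) y = F σ j hj hσ (stdSimplex.map θ y) := by
    intro m l σ θ j hj hσ y
    have := ConcreteCategory.congr_hom
      (f.naturality (Quiver.Hom.op (SimplexCategory.Hom.mk θ : ⦋l⦌ ⟶ ⦋m⦌))) ⟨_, mem σ j hj hσ⟩
    have h2 := congrArg (fun z => E.toSSetObjEquiv (op ⦋l⦌) z y) this
    exact h2
  have hne : ∀ j : Fin (n + 2), ({j}ᶜ : Set (Fin (n + 2))).Nonempty := fun j =>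
    Set.nonempty_compl.2 (by
      obtain ⟨k, hk⟩ := exists_ne j
      exact fun h => hk (h.symm ▸ Set.mem_univ k : k ∈ ({j} : Set (Fin (n + 2)))))
  -- Precomposition with a vertex retraction onto `{j}ᶜ` extends the map given on the face opposite
  -- to `j` to the whole simplex.
  choose e he he' using fun j => exists_monotone_retraction _ (hne j)
  let c : Fin (n + 2) → C(stdSimplex ℝ (Fin (n + 2)), E) := fun j =>
    -- The value at `j = i` is irrelevant; it only needs some point of `E`, taken from a simplex of
    -- the horn missing the vertex `e j 0`.
    if hj : j = i then ⟨fun _ => F (e (e j 0)) (e j 0) (fun h => he j 0 (h.trans hj.symm))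
      (he (e j 0)) (stdSimplex.vertex 0), continuous_const⟩ else F (e j) j hj (he j)
  have c_eq : ∀ j (hj : j ≠ i), c j = F (e j) j hj (he j) := fun j hj => dif_neg hj
  have F_congr : ∀ {m : ℕ} (σ σ' : Fin (m + 1) →o Fin (n + 2)) (j : Fin (n + 2)) (hj : j ≠ i)
      (hσ : ∀ x, σ x ≠ j) (hσ' : ∀ x, σ' x ≠ j), σ = σ' →
      F σ j hj hσ = F σ' j hj hσ' := by
    intro m σ σ' j hj hσ hσ' h
    subst h
    rfl
  have c_comp : ∀ {m : ℕ} (σ : Fin (m + 1) →o Fin (n + 2)) (j : Fin (n + 2)) (hj : j ≠ i)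
      (hσ : ∀ x, σ x ≠ j) (y), c j (stdSimplex.map σ y) = F σ j hj hσ y := by
    intro m σ j hj hσ y
    rw [c_eq j hj]
    refine (F_comp (e j) σ j hj (he j) y).symm.trans ?_
    exact congrArg (fun φ : C(_, E) => φ y)
      (F_congr _ σ j hj (fun x => he j _) hσ (OrderHom.ext _ _ (funext fun x => he' j _ (hσ x))))
  let b : C(stdSimplex ℝ (Fin (n + 2)), B) :=
    B.toSSetObjEquiv (op ⦋n + 1⦌) (yonedaEquiv g)
  have b_comp : ∀ {m : ℕ} (σ : Fin (m + 1) →o Fin (n + 2)) (j : Fin (n + 2)) (hj : j ≠ i)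
      (hσ : ∀ x, σ x ≠ j) (y), p (F σ j hj hσ y) = b (stdSimplex.map σ y) := by
    intro m σ j hj hσ y
    have h1 := ConcreteCategory.congr_hom (congr_app sq.w (op ⦋m⦌)) ⟨_, mem σ j hj hσ⟩
    have h2 : g.app (op ⦋m⦌) (stdSimplex.objMk (n := ⦋n + 1⦌) (m := op ⦋m⦌) σ) =
        (TopCat.toSSet.obj B).map (Quiver.Hom.op (SimplexCategory.Hom.mk σ : ⦋m⦌ ⟶ ⦋n + 1⦌))
          (yonedaEquiv g) := by
      obtain ⟨g', rfl⟩ := yonedaEquiv.symm.surjective g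
      rw [Equiv.apply_symm_apply]
      rfl
    have h3 := congrArg (fun z => B.toSSetObjEquiv (op ⦋m⦌) z y) (h1.trans h2)
    exact h3
  have hc : ∀ j k y, j ≠ i → k ≠ i → y j = 0 → y k = 0 → c j y = c k y := by
    intro j k y hj hk hyj hyk
    obtain ⟨x, hx⟩ : ∃ x, y x ≠ 0 := by
      by_contra! h0
      simpa [h0] using stdSimplex.sum_eq_one y
    -- A retraction onto the support of `y` misses both `j` and `k`, so both sides are values of one
    -- and the same simplex of the horn: `F` uses `j` only in proofs.
    obtain ⟨r, hr, hr'⟩ := exists_monotone_retraction {x | y x ≠ 0} ⟨x, hx⟩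
    have hy : stdSimplex.map r y = y := stdSimplex.map_eq_self _ _ hr'
    have hrj : ∀ x, r x ≠ j := fun x hx => hr x (hx ▸ hyj)
    have hrk : ∀ x, r x ≠ k := fun x hx => hr x (hx ▸ hyk)
    rw [← hy, c_comp r j hj hrj, c_comp r k hk hrk]
  have hb : ∀ j y, j ≠ i → y j = 0 → p (c j y) = b y := by
    intro j y hj hyj
    have hy : stdSimplex.map (e j) y = y :=
      stdSimplex.map_eq_self _ _ fun x hx => he' j x fun h => hx (h ▸ hyj)
    rw [c_eq j hj]
    exact (b_comp (e j) j hj (he j) y).trans (congrArg b hy)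
  obtain ⟨G, hG, hG'⟩ := h n i c b hc hb
  refine ⟨⟨⟨yonedaEquiv.symm ((E.toSSetObjEquiv (op ⦋n + 1⦌)).symm G), ?_, ?_⟩⟩⟩
  · ext ⟨⟨m⟩⟩ ⟨x, hx⟩
    obtain ⟨σ, rfl⟩ := stdSimplex.objMk_bijective.2 x
    obtain ⟨j, hj, hσ⟩ := (mem_horn_iff_notMem_range _ _).1 hx
    have hσ' : ∀ x, σ x ≠ j := fun x hx => hσ ⟨x, hx⟩
    refine (E.toSSetObjEquiv _).injective (ContinuousMap.ext fun y => ?_)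
    exact (hG j _ hj (stdSimplex.map_apply_eq_zero σ y j hσ')).trans (c_comp σ j hj hσ' y)
  · apply SSet.yonedaEquiv.injective
    refine (B.toSSetObjEquiv (op ⦋n + 1⦌)).injective (ContinuousMap.ext fun y => ?_)
    refine Eq.trans ?_ (hG' y)
    rw [SSet.yonedaEquiv_comp, Equiv.apply_symm_apply]
    rfl

/-! ### Retractions onto horns, and Kan fibrations of singular sets. -/

namespace stdSimplex

variable {n : ℕ} (i : Fin (n + 2))

/-- The smallest barycentric coordinate away from the vertex `i`. -/
noncomputable def hornHeight (x : stdSimplex ℝ (Fin (n + 2))) : ℝ :=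
  Finset.univ.inf' (Finset.univ_nonempty) fun k : Fin (n + 1) => x (i.succAbove k)

lemma continuous_hornHeight : Continuous (hornHeight i) := by
  refine Continuous.finset_inf'_apply _ fun k _ => ?_
  exact (continuous_apply _).comp continuous_subtype_val

lemma hornHeight_le (x : stdSimplex ℝ (Fin (n + 2))) {j : Fin (n + 2)} (hj : j ≠ i) :
    hornHeight i x ≤ x j := by
  obtain ⟨k, rfl⟩ := Fin.exists_succAbove_eq hj
  exact Finset.inf'_le (fun k : Fin (n + 1) => x (i.succAbove k)) (Finset.mem_univ k)

lemma hornHeight_nonneg (x : stdSimplex ℝ (Fin (n + 2))) : 0 ≤ hornHeight i x :=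
  Finset.le_inf' _ _ fun _ _ => stdSimplex.zero_le x _

lemma exists_hornHeight_eq (x : stdSimplex ℝ (Fin (n + 2))) :
    ∃ j, j ≠ i ∧ x j = hornHeight i x := by
  obtain ⟨k, -, hk⟩ := Finset.exists_mem_eq_inf' (Finset.univ_nonempty)
    (fun k : Fin (n + 1) => x (i.succAbove k))
  exact ⟨_, Fin.succAbove_ne i k, hk.symm⟩

lemma hornHeight_eq_zero (x : stdSimplex ℝ (Fin (n + 2))) {j : Fin (n + 2)} (hj : j ≠ i)
    (h : x j = 0) : hornHeight i x = 0 :=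
  le_antisymm (h ▸ hornHeight_le i x hj) (hornHeight_nonneg i x)

/-- Move the point `x` by `min s (hornHeight i x)` away from the face opposite to `i`. -/
noncomputable def pushToHorn (x : stdSimplex ℝ (Fin (n + 2))) (s : ℝ) :
    stdSimplex ℝ (Fin (n + 2)) :=
  -- Each of the `n + 2` coordinates loses the same amount and the vertex `i` receives the total.
  -- The outer `max 0` keeps the point in the simplex for negative `s`.
  ⟨fun j => x j - max 0 (min s (hornHeight i x)) +
      if j = i then (n + 2) * max 0 (min s (hornHeight i x)) else 0, by
    have h0 : 0 ≤ max 0 (min s (hornHeight i x)) := le_max_left _ _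
    have h1 : max 0 (min s (hornHeight i x)) ≤ hornHeight i x :=
      max_le (hornHeight_nonneg i x) (min_le_right _ _)
    refine ⟨fun j => ?_, ?_⟩
    · beta_reduce
      by_cases hj : j = i
      · have := stdSimplex.zero_le x j
        have h2 : (0 : ℝ) ≤ (n + 1) * max 0 (min s (hornHeight i x)) := by positivity
        rw [if_pos hj]
        linarith
      · have := hornHeight_le i x hj
        rw [if_neg hj]
        linarith
    · rw [Finset.sum_add_distrib, Finset.sum_sub_distrib, stdSimplex.sum_eq_one]
      simp⟩

lemma pushToHorn_apply (x : stdSimplex ℝ (Fin (n + 2))) (s : ℝ) (j : Fin (n + 2)) :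
    pushToHorn i x s j = x j - max 0 (min s (hornHeight i x)) +
      if j = i then (n + 2) * max 0 (min s (hornHeight i x)) else 0 := rfl

lemma pushToHorn_apply_of_ne (x : stdSimplex ℝ (Fin (n + 2))) (s : ℝ) {j : Fin (n + 2)}
    (hj : j ≠ i) : pushToHorn i x s j = x j - max 0 (min s (hornHeight i x)) := by
  rw [pushToHorn_apply, if_neg hj, add_zero]

lemma continuous_pushToHorn :
    Continuous fun q : stdSimplex ℝ (Fin (n + 2)) × ℝ => pushToHorn i q.1 q.2 := by
  have h : Continuous fun q : stdSimplex ℝ (Fin (n + 2)) × ℝ =>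
      max 0 (min q.2 (hornHeight i q.1)) :=
    continuous_const.max (continuous_snd.min ((continuous_hornHeight i).comp continuous_fst))
  refine Continuous.subtype_mk (continuous_pi fun j => ?_) _
  refine (Continuous.sub ?_ h).add ?_
  · exact (continuous_apply j).comp (continuous_subtype_val.comp continuous_fst)
  · split_ifs
    · exact continuous_const.mul h
    · exact continuous_const

lemma pushToHorn_eq_self (x : stdSimplex ℝ (Fin (n + 2))) (s : ℝ)
    (h : max 0 (min s (hornHeight i x)) = 0) : pushToHorn i x s = x := by
  ext j
  simp [pushToHorn_apply, h]

/-- Subtracting the full height annihilates the coordinate at which the minimum is attained. -/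
lemma exists_pushToHorn_eq_zero (x : stdSimplex ℝ (Fin (n + 2))) (s : ℝ)
    (h : hornHeight i x ≤ s) : ∃ j, j ≠ i ∧ pushToHorn i x s j = 0 := by
  obtain ⟨j, hj, hx⟩ := exists_hornHeight_eq i x
  refine ⟨j, hj, ?_⟩
  rw [pushToHorn_apply_of_ne i x s hj, min_eq_right h, max_eq_right (hornHeight_nonneg i x), hx,
    sub_self]

lemma isClosed_apply_eq_zero {X : Type*} [TopologicalSpace X]
    {f : X → stdSimplex ℝ (Fin (n + 2))} (hf : Continuous f) (j : Fin (n + 2)) :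
    IsClosed {x | f x j = 0} :=
  isClosed_singleton.preimage
    ((continuous_apply j).comp (continuous_subtype_val.comp hf) : Continuous fun x => f x j)

end stdSimplex

open SSet modelCategoryQuillen HomotopicalAlgebra in
/-- The singular simplicial set of a space is a Kan complex. -/
theorem TopCat.toSSet_map_mem_J_rlp_of_subsingleton {W B : TopCat.{u}} [Subsingleton B]
    (p : W ⟶ B) : J.rlp (TopCat.toSSet.map p) := by
  refine toSSet_map_mem_J_rlp p fun n i c b hc _ => ?_
  -- Heights are at most `1`, so `s = 1` moves every point onto the horn and gives a retraction.
  have hpush : Continuous fun x : stdSimplex ℝ (Fin (n + 2)) => stdSimplex.pushToHorn i x 1 :=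
    (stdSimplex.continuous_pushToHorn i).comp (.prodMk continuous_id continuous_const)
  obtain ⟨G, hG⟩ := exists_continuousMap_of_closed_cover
    (fun j : {j : Fin (n + 2) // j ≠ i} => {x | stdSimplex.pushToHorn i x 1 j.1 = 0})
    (fun j => stdSimplex.isClosed_apply_eq_zero hpush _)
    (fun x => by
      obtain ⟨j, hj, h⟩ := stdSimplex.exists_pushToHorn_eq_zero i x 1 (by
        obtain ⟨j, -, hj⟩ := stdSimplex.exists_hornHeight_eq i x
        exact hj ▸ stdSimplex.le_one x j)
      exact ⟨⟨j, hj⟩, h⟩)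
    (fun j => (c j.1).comp ⟨_, hpush⟩) (fun j k x hj hk => hc _ _ _ j.2 k.2 hj hk)
  refine ⟨G, fun j y hj hy => ?_, fun y => Subsingleton.elim _ _⟩
  have h : stdSimplex.pushToHorn i y 1 = y :=
    stdSimplex.pushToHorn_eq_self i y 1 (by simp [stdSimplex.hornHeight_eq_zero i y hj hy])
  exact (hG ⟨j, hj⟩ y (show stdSimplex.pushToHorn i y 1 j = 0 by rw [h, hy])).trans
    (congrArg (c j) h)

/-- The evaluation of paths at their two ends. -/
def TopCat.pathEnds (W : TopCat.{u}) : TopCat.of C(unitInterval, W) ⟶ TopCat.of (W × W) :=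
  TopCat.ofHom ⟨fun γ => (γ 0, γ 1), by fun_prop⟩

namespace stdSimplex

variable {n : ℕ} (i : Fin (n + 2))

/-- Together with `pushToHorn`, this defines a retraction of the product of a simplex and the unit
interval onto the union of the product of a horn with the interval and of the two ends. -/
noncomputable def stretch (x : stdSimplex ℝ (Fin (n + 2))) (t : unitInterval) : unitInterval :=
  -- With `h` the height, `[h/4, 1 - h/4]` is mapped affinely onto `[0, 1]` and the rest is clipped
  -- to the ends. On the horn, where `h = 0`, this is the identity.
  Set.projIcc 0 1 zero_le_one ((t - hornHeight i x / 4) / (1 - hornHeight i x / 2))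

lemma hornHeight_le_one (x : stdSimplex ℝ (Fin (n + 2))) : hornHeight i x ≤ 1 := by
  obtain ⟨j, -, hj⟩ := exists_hornHeight_eq i x
  exact hj ▸ stdSimplex.le_one x j

lemma continuous_stretch :
    Continuous fun q : stdSimplex ℝ (Fin (n + 2)) × unitInterval => stretch i q.1 q.2 := by
  have h := (continuous_hornHeight i).comp
    (continuous_fst (X := stdSimplex ℝ (Fin (n + 2))) (Y := unitInterval))
  refine continuous_projIcc.comp (Continuous.div ?_ ?_ fun q => ?_)
  · exact (continuous_subtype_val.comp continuous_snd).sub (h.div_const 4)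
  · exact continuous_const.sub (h.div_const 2)
  · have := hornHeight_le_one i q.1
    linarith

lemma stretch_eq_zero (x : stdSimplex ℝ (Fin (n + 2))) (t : unitInterval)
    (h : (t : ℝ) ≤ hornHeight i x / 4) : stretch i x t = 0 := by
  have := hornHeight_le_one i x
  exact Set.projIcc_of_le_left _ (div_nonpos_of_nonpos_of_nonneg (by linarith) (by linarith))

lemma stretch_eq_one (x : stdSimplex ℝ (Fin (n + 2))) (t : unitInterval)
    (h : 1 - (t : ℝ) ≤ hornHeight i x / 4) : stretch i x t = 1 := by
  have := hornHeight_le_one i x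
  refine Set.projIcc_of_right_le _ ((one_le_div (by linarith)).2 (by linarith))

lemma stretch_eq_self (x : stdSimplex ℝ (Fin (n + 2))) (t : unitInterval)
    (h : hornHeight i x = 0) : stretch i x t = t := by
  simp [stretch, h]

end stdSimplex

open SSet modelCategoryQuillen HomotopicalAlgebra in
/-- The path fibration induces a Kan fibration on singular simplicial sets. -/
theorem TopCat.toSSet_map_pathEnds_mem_J_rlp (W : TopCat.{u}) :
    J.rlp (TopCat.toSSet.map W.pathEnds) := by
  refine toSSet_map_mem_J_rlp _ fun n i c b hc hb => ?_
  -- The factor `4` matches the quarters in `stretch`: for `t` in `[h/4, 1 - h/4]` the push reaches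
  -- the horn, and for other `t` the map `T` is already `0` or `1`. So `(P, T)` lands in the horn
  -- cylinder together with the two ends.
  let P : C(stdSimplex ℝ (Fin (n + 2)) × unitInterval, stdSimplex ℝ (Fin (n + 2))) :=
    ⟨fun q => stdSimplex.pushToHorn i q.1 (4 * min (q.2 : ℝ) (1 - q.2)),
      (stdSimplex.continuous_pushToHorn i).comp (continuous_fst.prodMk (by fun_prop))⟩
  let T : C(stdSimplex ℝ (Fin (n + 2)) × unitInterval, unitInterval) :=
    ⟨fun q => stdSimplex.stretch i q.1 q.2, stdSimplex.continuous_stretch i⟩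
  let ev : C(C(unitInterval, W) × unitInterval, W) := ⟨fun q => q.1 q.2, by fun_prop⟩
  have hends : ∀ j y, j ≠ i → y j = 0 → ((c j y) 0, (c j y) 1) = b y := hb
  obtain ⟨G, hG⟩ := exists_continuousMap_of_closed_cover
    (Sum.elim (fun j : {j : Fin (n + 2) // j ≠ i} => {q | P q j.1 = 0})
      (fun e : Bool => {q | T q = if e then 1 else 0}))
    (by
      rintro (j | e)
      · exact stdSimplex.isClosed_apply_eq_zero P.continuous _
      · exact isClosed_singleton.preimage T.continuous)
    (by
      intro q
      by_cases h : stdSimplex.hornHeight i q.1 ≤ 4 * min (q.2 : ℝ) (1 - q.2)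
      · obtain ⟨j, hj, h⟩ := stdSimplex.exists_pushToHorn_eq_zero i q.1 _ h
        exact ⟨.inl ⟨j, hj⟩, h⟩
      · rcases le_total (q.2 : ℝ) (1 - q.2) with h' | h'
        · rw [min_eq_left h'] at h
          exact ⟨.inr false, stdSimplex.stretch_eq_zero i _ _ (by linarith)⟩
        · rw [min_eq_right h'] at h
          exact ⟨.inr true, stdSimplex.stretch_eq_one i _ _ (by linarith)⟩)
    (Sum.elim (fun j => ev.comp (((c j.1).comp P).prodMk T))
      (fun e => if e then (ContinuousMap.snd.comp b).comp P else (ContinuousMap.fst.comp b).comp P))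
    (by
      have aux : ∀ (j : {j : Fin (n + 2) // j ≠ i}) (e : Bool) q, P q j.1 = 0 →
          (T q = if e then 1 else 0) → (c j.1 (P q)) (T q) =
          (if e then (ContinuousMap.snd.comp b).comp P else (ContinuousMap.fst.comp b).comp P) q := by
        intro j e q hj he
        have := hends j.1 (P q) j.2 hj
        rw [he]
        cases e
        · exact congrArg Prod.fst this
        · exact congrArg Prod.snd this
      rintro (j | e) (k | e') q hj hk
      · exact congrArg (fun γ : C(unitInterval, W) => γ (T q)) (hc _ _ _ j.2 k.2 hj hk)
      · exact aux j e' q hj hk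
      · exact (aux k e q hk hj).symm
      · have h : (if e then 1 else 0 : unitInterval) = if e' then 1 else 0 := hj.symm.trans hk
        cases e <;> cases e' <;> simp at h ⊢)
  have hend : ∀ y (t : unitInterval), (t : ℝ) = 0 ∨ (t : ℝ) = 1 → P (y, t) = y := by
    intro y t ht
    refine stdSimplex.pushToHorn_eq_self i y _ ?_
    have h := stdSimplex.hornHeight_nonneg i y
    rcases ht with ht | ht <;> simp [ht, h]
  refine ⟨G.curry, fun j y hj hy => ContinuousMap.ext fun t => ?_, fun y => ?_⟩
  · have h0 := stdSimplex.hornHeight_eq_zero i y hj hy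
    have hP : P (y, t) = y := stdSimplex.pushToHorn_eq_self i y _ (by
      have : 0 ≤ 4 * min (t : ℝ) (1 - t) :=
        mul_nonneg (by norm_num) (le_min t.2.1 (sub_nonneg.2 t.2.2))
      rw [h0, min_eq_right this, max_self])
    have hT : T (y, t) = t := stdSimplex.stretch_eq_self i y t h0
    refine (hG (.inl ⟨j, hj⟩) (y, t) (by rw [← hy]; exact congrArg (fun z => z j) hP)).trans ?_
    change (c j (P (y, t))) (T (y, t)) = _
    rw [hP, hT]
  · have h := stdSimplex.hornHeight_nonneg i y
    refine Prod.ext ?_ ?_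
    · refine (hG (.inr false) (y, 0) (stdSimplex.stretch_eq_zero i _ _ (by simpa using div_nonneg h zero_le_four))).trans ?_
      exact congrArg (fun z => (b z).1) (hend y 0 (by simp))
    · refine (hG (.inr true) (y, 1) (stdSimplex.stretch_eq_one i _ _ (by simpa using div_nonneg h zero_le_four))).trans ?_
      exact congrArg (fun z => (b z).2) (hend y 1 (by simp))

/-! ### Realizations of anodyne extensions. -/

/-- The property of being (the map underlying) a homotopy equivalence. -/
def ContinuousMap.IsHomotopyEquiv {X Y : Type*} [TopologicalSpace X] [TopologicalSpace Y]
    (f : C(X, Y)) : Prop :=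
  ∃ e : ContinuousMap.HomotopyEquiv X Y, e.toFun = f

namespace ContinuousMap.IsHomotopyEquiv

variable {X Y Z : Type*} [TopologicalSpace X] [TopologicalSpace Y] [TopologicalSpace Z]

lemma comp {g : C(Y, Z)} {f : C(X, Y)} (hg : g.IsHomotopyEquiv) (hf : f.IsHomotopyEquiv) :
    (g.comp f).IsHomotopyEquiv := by
  obtain ⟨e, rfl⟩ := hf
  obtain ⟨e', rfl⟩ := hg
  exact ⟨e.trans e', rfl⟩

/-- For a homotopy inverse `k` of `f`, one has `f g ≃ f g f k = f k ≃ id`, so `f` is also a homotopy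
inverse of `g`. -/
lemma of_comp_eq_id {g : C(Y, X)} {f : C(X, Y)} (hf : f.IsHomotopyEquiv)
    (h : g.comp f = ContinuousMap.id X) : g.IsHomotopyEquiv := by
  obtain ⟨e, rfl⟩ := hf
  have hfg : (e.toFun.comp g).Homotopic (ContinuousMap.id Y) := by
    have h1 : (e.toFun.comp g).Homotopic ((e.toFun.comp g).comp (e.toFun.comp e.invFun)) :=
      (ContinuousMap.Homotopic.refl (e.toFun.comp g)).comp e.right_inv.symm
    have h2 : (e.toFun.comp g).comp (e.toFun.comp e.invFun) = e.toFun.comp e.invFun := by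
      calc _ = e.toFun.comp ((g.comp e.toFun).comp e.invFun) := rfl
        _ = _ := by rw [h]; rfl
    exact (h2 ▸ h1).trans e.right_inv
  exact ⟨⟨g, e.toFun, hfg, h ▸ ContinuousMap.Homotopic.refl _⟩, rfl⟩

end ContinuousMap.IsHomotopyEquiv

open SSet modelCategoryQuillen in
/-- The realization of an anodyne extension is a homotopy equivalence. -/
theorem SSet.anodyneExtensions.isHomotopyEquiv_toTop_map {A B : SSet.{u}} {i : A ⟶ B}
    (hi : anodyneExtensions i) : (SSet.toTop.map i).hom.IsHomotopyEquiv := by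
  have hK : HasLiftingProperty i (TopCat.toSSet.map (TopCat.ofHom
      (⟨fun _ => PUnit.unit, continuous_const⟩ :
        C(SSet.toTop.obj A, (TopCat.of PUnit.{u + 1}))))) :=
    hi _ (TopCat.toSSet_map_mem_J_rlp_of_subsingleton (B := TopCat.of PUnit.{u + 1}) _)
  have hP : HasLiftingProperty i (TopCat.toSSet.map (SSet.toTop.obj B).pathEnds) :=
    hi _ (TopCat.toSSet_map_pathEnds_mem_J_rlp _)
  -- By adjunction the realization of `i` lifts against `A → pt`, which yields a retraction, and
  -- against path evaluation, which yields a homotopy.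
  rw [← sSetTopAdj.hasLiftingProperty_iff] at hK hP
  have sq : CommSq (𝟙 (SSet.toTop.obj A)) (SSet.toTop.map i)
    (TopCat.ofHom
      (⟨fun _ => PUnit.unit, continuous_const⟩ : C(SSet.toTop.obj A, (TopCat.of PUnit.{u + 1}))))
    (TopCat.ofHom
      (⟨fun _ => PUnit.unit, continuous_const⟩ : C(SSet.toTop.obj B, (TopCat.of PUnit.{u + 1})))) :=
    ⟨rfl⟩
  let r := sq.lift
  have hr : SSet.toTop.map i ≫ r = 𝟙 _ := sq.fac_left
  let K : C(SSet.toTop.obj A, C(unitInterval, SSet.toTop.obj B)) :=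
    ⟨fun a => ContinuousMap.const _ ((SSet.toTop.map i).hom a),
      ContinuousMap.continuous_const'.comp (SSet.toTop.map i).hom.continuous⟩
  have hr' : ∀ a, r.hom ((SSet.toTop.map i).hom a) = a := fun a => ConcreteCategory.congr_hom hr a
  -- A lift is a homotopy from `i ∘ r` to the identity, constant on the image of `i`; the square
  -- commutes because `r` is a retraction.
  have sq' : CommSq (TopCat.ofHom K : SSet.toTop.obj A ⟶ TopCat.of C(unitInterval, SSet.toTop.obj B))
    (SSet.toTop.map i) (SSet.toTop.obj B).pathEnds
    (TopCat.ofHom (((SSet.toTop.map i).hom.comp r.hom).prodMk (ContinuousMap.id _))) := by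
    refine ⟨TopCat.hom_ext (ContinuousMap.ext fun a => ?_)⟩
    exact Prod.ext (congrArg (SSet.toTop.map i).hom (hr' a).symm) rfl
  have hl : ∀ b, ((sq'.lift.hom b) 0, (sq'.lift.hom b) 1) =
      ((SSet.toTop.map i).hom (r.hom b), b) := fun b => ConcreteCategory.congr_hom sq'.fac_right b
  let H : ((SSet.toTop.map i).hom.comp r.hom).Homotopy (ContinuousMap.id _) :=
    { toFun := fun q => (sq'.lift.hom q.2) q.1
      continuous_toFun := by
        have := sq'.lift.hom.continuous
        fun_prop
      map_zero_left := fun b => congrArg Prod.fst (hl b)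
      map_one_left := fun b => congrArg Prod.snd (hl b) }
  refine ⟨⟨(SSet.toTop.map i).hom, r.hom, ?_, ⟨H⟩⟩, rfl⟩
  rw [show r.hom.comp (SSet.toTop.map i).hom = ContinuousMap.id _ from ContinuousMap.ext hr']

/-! ### The column filtration of the diagonal of a bisimplicial set. -/

namespace SSet

open Limits MonoidalCategory

/-- Attaching along an anodyne extension: a subcomplex `D = C ⊔ range Φ`, where `Φ` is injective
outside of the preimage `S` of `C`, is an anodyne extension of `C` if `S` is one of its ambient
simplicial set. -/
lemma anodyneExtensions_homOfLE_of_map {X Y : SSet.{u}} (Φ : X ⟶ Y) {C D : Y.Subcomplex}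
    (hCD : C ≤ D) (hD : D = C ⊔ Subcomplex.range Φ)
    (hΦ : ∀ (n : SimplexCategoryᵒᵖ) (x y : X.obj n), x ∉ (C.preimage Φ).obj n →
      y ∉ (C.preimage Φ).obj n → Φ.app n x = Φ.app n y → x = y)
    (h : anodyneExtensions (C.preimage Φ).ι) :
    anodyneExtensions (Subcomplex.homOfLE hCD) := by
  let b : X ⟶ D := Subcomplex.lift Φ (by rw [hD]; exact le_sup_right)
  let t : ((C.preimage Φ : X.Subcomplex) : SSet) ⟶ C :=
    Subcomplex.lift ((C.preimage Φ).ι ≫ Φ) (by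
      rintro n _ ⟨x, rfl⟩
      exact x.2)
  have : IsPushout t (C.preimage Φ).ι (Subcomplex.homOfLE hCD) b := by
    refine IsPushout.of_forall_isPushout_app fun n => ?_
    refine Types.isPushout_of_isPullback_of_mono' ?_ ?_ ?_
    · rw [Types.isPullback_iff]
      refine ⟨rfl, fun x₁ x₂ ⟨_, h⟩ => Subtype.ext h, fun x y h => ?_⟩
      have h' : x.1 = Φ.app n y := congrArg Subtype.val h
      refine ⟨⟨y, ?_⟩, Subtype.ext h'.symm, rfl⟩
      change Φ.app n y ∈ C.obj n
      rw [← h']; exact x.2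
    · refine Set.eq_univ_of_forall fun ⟨x, hx⟩ => ?_
      subst hD
      obtain hx' | ⟨y, rfl⟩ := hx
      · exact Or.inl ⟨⟨x, hx'⟩, rfl⟩
      · exact Or.inr ⟨y, rfl⟩
    · intro x y hx hy hxy
      exact hΦ n x y (fun h => hx ⟨⟨x, h⟩, rfl⟩) (fun h => hy ⟨⟨y, h⟩, rfl⟩)
        (congrArg Subtype.val hxy)
  exact MorphismProperty.of_isPushout this h

/-- The union of a sequence of anodyne extensions is an anodyne extension. -/
lemma anodyneExtensions_ι_of_monotone {X : SSet.{u}} (A : ℕ →o X.Subcomplex)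
    (hA : ⨆ n, A n = ⊤)
    (h : ∀ n, anodyneExtensions (Subcomplex.homOfLE (A.monotone (Nat.le_succ n)))) :
    anodyneExtensions (A 0).ι := by
  refine MorphismProperty.transfiniteCompositionsOfShape_le _ ℕ _ ⟨?_⟩
  exact
    { F := A.monotone.functor ⋙ Subcomplex.toSSetFunctor
      isoBot := Iso.refl _
      incl := { app := fun _ => Subcomplex.ι _ }
      isColimit :=
        IsColimit.ofIsoColimit (isColimitOfPreserves (Subcomplex.toSSetFunctor)
          ((CompleteLattice.colimitCocone (A.monotone.functor)).isColimit))
            (Cocone.ext (Subcomplex.eqToIso hA ≪≫ Subcomplex.topIso X))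
      fac := rfl
      map_mem := fun n _ => h n }

/-- The diagonal of a bisimplicial set. -/
abbrev diagonal (B : SimplexCategoryᵒᵖ ⥤ SSet.{u}) : SSet.{u} :=
  Functor.diag SimplexCategoryᵒᵖ ⋙ Functor.uncurry.obj B

section Diagonal

variable {B : SimplexCategoryᵒᵖ ⥤ SSet.{u}}

/-- This shows that a diagonal simplex coming from a given column still comes from that column after
applying a simplicial operator. -/
lemma diagonal_map_map {k k' m : SimplexCategoryᵒᵖ} (f : k ⟶ k') (θ : m ⟶ k)
    (y : (B.obj m).obj k) :
    (diagonal B).map f ((B.map θ).app k y) = (B.map (θ ≫ f)).app k' ((B.obj m).map f y) := by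
  change (B.obj k').map f ((B.map f).app k ((B.map θ).app k y)) = _
  rw [B.map_comp]
  exact ((NatTrans.naturality_apply (B.map f) f _).symm).trans
    (congrArg ((B.map f).app k') (NatTrans.naturality_apply (B.map θ) f y).symm)

variable (B) in
/-- The `k`-th row of a bisimplicial set. -/
abbrev row (k : SimplexCategoryᵒᵖ) : SSet.{u} := B.flip.obj k

variable (B) in
/-- The horizontally degenerate simplices in the column of index `N`. -/
def columnDegenerate (N : ℕ) : (B.obj (op ⦋N⦌)).Subcomplex where
  obj k := {x | x ∈ (row B k).degenerate N}
  map {k k'} f := by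
    rintro x ⟨m, hm, θ, y, rfl⟩
    exact ⟨m, hm, θ, (B.obj (op ⦋m⦌)).map f y, NatTrans.naturality_apply (B.map θ.op) f y⟩

variable (A : ∀ m, (B.obj m).Subcomplex)
  (hA : ∀ {m m' : SimplexCategoryᵒᵖ} (f : m ⟶ m') (k : SimplexCategoryᵒᵖ) (x : (B.obj m).obj k),
    x ∈ (A m).obj k → (B.map f).app k x ∈ (A m').obj k)

/-- The simplices of the diagonal which are in `A` or come from a column of index `< N`. -/
def diagonalFiltration (N : ℕ) : (diagonal B).Subcomplex where
  obj k := {x | x ∈ (A k).obj k ∨ ∃ m < N, ∃ (θ : k.unop ⟶ ⦋m⦌) (y : (B.obj (op ⦋m⦌)).obj k),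
    (B.map θ.op).app k y = x}
  map {k k'} f := by
    rintro x (hx | ⟨m, hm, θ, y, rfl⟩)
    · exact Or.inl ((A k').map f (hA f k x hx))
    · exact Or.inr ⟨m, hm, f.unop ≫ θ, _, (diagonal_map_map f θ.op y).symm⟩

variable (B) in
/-- The simplices of the diagonal coming from the column of index `N`. -/
def columnMap (N : ℕ) : (Δ[N] : SSet.{u}) ⊗ B.obj (op ⦋N⦌) ⟶ diagonal B where
  app k := ↾fun x => (B.map (stdSimplex.objEquiv x.1).op).app k x.2
  naturality k k' f := by
    ext ⟨x, y⟩
    exact (diagonal_map_map f (stdSimplex.objEquiv x).op y).symm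

lemma mem_boundary_iff_not_epi {N : ℕ} {k : SimplexCategoryᵒᵖ} (x : (Δ[N] : SSet.{u}).obj k) :
    x ∈ (boundary N : (Δ[N] : SSet.{u}).Subcomplex).obj k ↔ ¬ Epi (stdSimplex.objEquiv x) := by
  rw [SimplexCategory.epi_iff_surjective]
  rfl

lemma mem_unionProd_boundary_iff {N : ℕ} {X : SSet.{u}} (T : X.Subcomplex)
    {k : SimplexCategoryᵒᵖ} (θ : k.unop ⟶ ⦋N⦌) (y : X.obj k) :
    ((stdSimplex.objEquiv.symm θ, y) : ((Δ[N] : SSet.{u}) ⊗ X).obj k) ∈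
      (Subcomplex.unionProd (boundary N) T).obj k ↔ y ∈ T.obj k ∨ ¬ Epi θ := by
  refine (Subcomplex.mem_unionProd_iff _ _ _).trans (or_congr Iff.rfl ?_)
  refine (mem_boundary_iff_not_epi _).trans ?_
  rw [Equiv.apply_symm_apply]

/-- For epi `θ`, a section recovers `y` from its image: membership of the image in `A` passes to
`y`, and an image from a lower column makes `y` horizontally degenerate. A non-epi `θ` factors
through a smaller simplex, so its image always comes from a lower column. -/
lemma preimage_columnMap (N : ℕ) :
    (diagonalFiltration A hA N).preimage (columnMap B N) =
      Subcomplex.unionProd (boundary N) (A (op ⦋N⦌) ⊔ columnDegenerate B N) := by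
  ext k ⟨x, y⟩
  obtain ⟨θ, rfl⟩ := stdSimplex.objEquiv.symm.surjective x
  refine Iff.trans ?_ (mem_unionProd_boundary_iff _ _ _).symm
  change ((B.map θ.op).app k y ∈ (A k).obj k ∨ ∃ m < N, ∃ (η : k.unop ⟶ ⦋m⦌)
    (z : (B.obj (op ⦋m⦌)).obj k), (B.map η.op).app k z = (B.map θ.op).app k y) ↔
    (y ∈ (A (op ⦋N⦌)).obj k ∨ y ∈ (row B k).degenerate N) ∨ ¬ Epi θ
  constructor
  · intro h
    by_cases hθ : Epi θ
    · left
      let σ : ⦋N⦌ ⟶ k.unop := (isSplitEpi_of_epi θ).exists_splitEpi.some.section_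
      have hσ : σ ≫ θ = 𝟙 _ := (isSplitEpi_of_epi θ).exists_splitEpi.some.id
      have hy : (B.map σ.op).app k ((B.map θ.op).app k y) = y := by
        have : B.map θ.op ≫ B.map σ.op = 𝟙 _ := by
          rw [← B.map_comp, ← op_comp, hσ, op_id, B.map_id]
        exact ConcreteCategory.congr_hom (congr_app this k) y
      obtain h | ⟨m, hm, η, z, h⟩ := h
      · exact Or.inl (hy ▸ hA σ.op k _ h)
      · refine Or.inr ⟨m, hm, σ ≫ η, z, ?_⟩
        rw [← hy, ← h]
        exact ConcreteCategory.congr_hom (congr_app (B.map_comp η.op σ.op) k) z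
    · exact Or.inr hθ
  · rintro ((h | ⟨m, hm, η, z, rfl⟩) | h)
    · exact Or.inl (hA _ _ _ h)
    · exact Or.inr ⟨m, hm, θ ≫ η, z,
        ConcreteCategory.congr_hom (congr_app (B.map_comp η.op θ.op) k) z⟩
    · refine Or.inr ⟨(image θ).len, ?_, factorThruImage θ, (B.map (image.ι θ).op).app k y, ?_⟩
      · refine lt_of_le_of_ne (SimplexCategory.len_le_of_mono (image.ι θ)) fun hlen => h ?_
        have := SimplexCategory.isIso_iff_of_mono (image.ι θ) |>.2 hlen
        rw [← image.fac θ]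
        infer_instance
      · have := B.map_comp (image.ι θ).op (factorThruImage θ).op
        rw [← op_comp, image.fac θ] at this
        exact (ConcreteCategory.congr_hom (congr_app this k) y).symm

/-- Outside the union the operator is epi and the simplex nondegenerate in its row, so this is
uniqueness in the Eilenberg–Zilber decomposition of simplices of the row. -/
lemma columnMap_injective (N : ℕ) (k : SimplexCategoryᵒᵖ)
    (x y : ((Δ[N] : SSet.{u}) ⊗ B.obj (op ⦋N⦌)).obj k)
    (hx : x ∉ (Subcomplex.unionProd (boundary N) (A (op ⦋N⦌) ⊔ columnDegenerate B N)).obj k)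
    (hy : y ∉ (Subcomplex.unionProd (boundary N) (A (op ⦋N⦌) ⊔ columnDegenerate B N)).obj k)
    (h : (columnMap B N).app k x = (columnMap B N).app k y) : x = y := by
  obtain ⟨x, x'⟩ := x
  obtain ⟨y, y'⟩ := y
  induction k using Opposite.rec with | _ k
  induction k using SimplexCategory.rec with | _ k
  obtain ⟨θ, rfl⟩ := stdSimplex.objEquiv.symm.surjective x
  obtain ⟨η, rfl⟩ := stdSimplex.objEquiv.symm.surjective y
  replace hx := (not_congr (mem_unionProd_boundary_iff _ _ _)).1 hx
  replace hy := (not_congr (mem_unionProd_boundary_iff _ _ _)).1 hy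
  rw [not_or, not_not] at hx hy
  obtain ⟨hx', _⟩ := hx
  obtain ⟨hy', _⟩ := hy
  have hx'' : x' ∈ (row B (op ⦋k⦌)).nonDegenerate N := fun h => hx' (Or.inr h)
  have hy'' : y' ∈ (row B (op ⦋k⦌)).nonDegenerate N := fun h => hy' (Or.inr h)
  have h' : (row B (op ⦋k⦌)).map θ.op x' = (row B (op ⦋k⦌)).map η.op y' := h
  obtain rfl : x' = y' := congrArg Subtype.val ((row B (op ⦋k⦌)).unique_nonDegenerate_simplex _
    θ ⟨_, hx''⟩ rfl η ⟨_, hy''⟩ h')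
  obtain rfl : θ = η := (row B (op ⦋k⦌)).unique_nonDegenerate_map _
    θ ⟨_, hx''⟩ rfl η ⟨_, hy''⟩ h'
  rfl

include hA in
/-- A subobject `A` of a bisimplicial set `B` induces an anodyne extension of diagonals if, for
every column, adjoining the horizontally degenerate simplices to `A` gives an anodyne extension. -/
theorem anodyneExtensions_diagonal_ι
    (h : ∀ N, anodyneExtensions (A (op ⦋N⦌) ⊔ columnDegenerate B N).ι)
    (S : (diagonal B).Subcomplex) (hS : ∀ k x, x ∈ S.obj k ↔ x ∈ (A k).obj k) :
    anodyneExtensions S.ι := by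
  let F : ℕ →o (diagonal B).Subcomplex :=
    ⟨diagonalFiltration A hA, fun N N' hN k x hx => hx.imp_right
      fun ⟨m, hm, h⟩ => ⟨m, hm.trans_le hN, h⟩⟩
  obtain rfl : F 0 = S := by
    ext k x
    rw [hS]
    exact ⟨fun h => h.elim id fun ⟨m, hm, _⟩ => absurd hm (Nat.not_lt_zero m), Or.inl⟩
  refine anodyneExtensions_ι_of_monotone F ?_ fun N => ?_
  · refine top_le_iff.1 fun k x _ => ?_
    -- A diagonal `k`-simplex lies in column `k`, so the identity operator puts it in stage `k + 1`.
    refine (le_iSup F (k.unop.len + 1)) k (Or.inr ⟨k.unop.len, Nat.lt_succ_self _, 𝟙 _, x, ?_⟩)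
    exact ConcreteCategory.congr_hom (congr_app (B.map_id k) k) x
  · refine anodyneExtensions_homOfLE_of_map (columnMap B N) _ ?_ ?_ ?_
    · ext k x
      constructor
      · rintro (h | ⟨m, hm, θ, y, rfl⟩)
        · exact Or.inl (Or.inl h)
        · obtain hm | rfl := (Nat.lt_succ_iff_lt_or_eq).1 hm
          · exact Or.inl (Or.inr ⟨m, hm, θ, y, rfl⟩)
          · refine Or.inr ⟨⟨stdSimplex.objEquiv.symm θ, y⟩, ?_⟩
            change (B.map (stdSimplex.objEquiv.{u} (stdSimplex.objEquiv.symm θ)).op).app k y = _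
            rw [Equiv.apply_symm_apply]
      · rintro ((h | ⟨m, hm, h⟩) | ⟨y, rfl⟩)
        · exact Or.inl h
        · exact Or.inr ⟨m, hm.trans (Nat.lt_succ_self N), h⟩
        · exact Or.inr ⟨N, Nat.lt_succ_self N, _, _, rfl⟩
    · intro k x y hx hy
      have := preimage_columnMap A hA N
      exact columnMap_injective A N k x y (this ▸ hx) (this ▸ hy)
    · have := preimage_columnMap A hA N
      change anodyneExtensions ((diagonalFiltration A hA N).preimage (columnMap B N)).ι
      rw [this]
      exact anodyneExtensions_unionProd_ι _ _ (h N)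

end Diagonal

end SSet

/-! ### Anodyne extensions from deformations. -/

namespace SSet

open Limits MonoidalCategory

/-- The horn `horn 1 e` is the vertex `e` itself: a simplex reaching the other vertex would, with
`e`, exhaust `Fin 2`. -/
lemma eq_const_of_mem_horn_one {e : Fin 2} {k : SimplexCategoryᵒᵖ} {t : (Δ[1] : SSet.{u}).obj k}
    (ht : t ∈ (horn.{u} 1 e).obj k) : t = stdSimplex.const 1 e k := by
  rw [mem_horn_iff] at ht
  obtain ⟨f, rfl⟩ := stdSimplex.objEquiv.symm.surjective t
  have : ∀ i, f.toOrderHom i = e := by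
    by_contra! h
    obtain ⟨i, hi⟩ := h
    refine ht (Set.eq_univ_of_forall fun j => ?_)
    by_cases hj : j = e
    · exact Or.inr hj
    · refine Or.inl ⟨i, ?_⟩
      change f.toOrderHom i = j
      generalize f.toOrderHom i = a at hi ⊢
      fin_cases e <;> fin_cases a <;> fin_cases j <;> simp_all
  refine congrArg stdSimplex.objEquiv.symm (SimplexCategory.Hom.ext _ _ (OrderHom.ext _ _ ?_))
  exact funext this

/-- The inclusion of a subcomplex onto which the simplicial set retracts by a deformation which
preserves the subcomplex is an anodyne extension. -/
lemma anodyneExtensions_ι_of_homotopy {X : SSet.{u}} (S : X.Subcomplex) (e : Fin 2)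
    (H : X ⊗ (Δ[1] : SSet.{u}) ⟶ X)
    (h₀ : ∀ k (x : X.obj k), H.app k (x, stdSimplex.const 1 e.rev k) = x)
    (h₁ : ∀ k (x : X.obj k), H.app k (x, stdSimplex.const 1 e k) ∈ S.obj k)
    (hS : ∀ k (x : X.obj k) (t : (Δ[1] : SSet.{u}).obj k),
      x ∈ S.obj k → H.app k (x, t) ∈ S.obj k) :
    anodyneExtensions S.ι := by
  have key : anodyneExtensions (Subcomplex.unionProd S (horn.{u} 1 e)).ι :=
    anodyneExtensions_unionProd_ι _ _ (.horn_ι e)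
  -- The inclusion `S.ι` is a retract of the one in `key`: it is embedded at the end `e.rev` of the
  -- cylinder and `H` retracts it back.
  let c : X ⟶ X ⊗ (Δ[1] : SSet.{u}) :=
    { app := fun k => ↾fun x => (x, stdSimplex.const 1 e.rev k) }
  have hc : c ≫ H = 𝟙 X := by
    ext k x
    exact h₀ k x
  refine anodyneExtensions.of_retract (?_ : RetractArrow S.ι _) key
  refine
    { i := Arrow.homMk (Subcomplex.lift (S.ι ≫ c) ?_) c rfl
      r := Arrow.homMk (Subcomplex.lift ((Subcomplex.unionProd S (horn.{u} 1 e)).ι ≫ H) ?_) H rfl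
      retract := ?_ }
  · rintro k _ ⟨x, rfl⟩
    exact Or.inr ⟨x.2, trivial⟩
  · rintro k _ ⟨⟨⟨x, t⟩, hx | hx⟩, rfl⟩
    · have ht : t ∈ (horn.{u} 1 e).obj k := hx.2
      obtain rfl := eq_const_of_mem_horn_one ht
      exact h₁ k x
    · exact hS k x t hx.1
  · refine Arrow.hom_ext _ _ ?_ hc
    ext k x
    exact Subtype.ext (h₀ k x.1)

section Diagonal

variable {B : SimplexCategoryᵒᵖ ⥤ SSet.{u}} (A : ∀ m, (B.obj m).Subcomplex)
  (hA : ∀ {m m' : SimplexCategoryᵒᵖ} (f : m ⟶ m') (k : SimplexCategoryᵒᵖ) (x : (B.obj m).obj k),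
    x ∈ (A m).obj k → (B.map f).app k x ∈ (A m').obj k)

include hA in
/-- Columnwise deformations onto `A` which commute with the horizontal degeneracies make the
diagonal inclusion anodyne. -/
theorem anodyneExtensions_diagonal_ι_of_homotopy (e : Fin 2)
    (H : ∀ m, B.obj m ⊗ (Δ[1] : SSet.{u}) ⟶ B.obj m)
    (h₀ : ∀ m k (x : (B.obj m).obj k), (H m).app k (x, stdSimplex.const 1 e.rev k) = x)
    (h₁ : ∀ m k (x : (B.obj m).obj k), (H m).app k (x, stdSimplex.const 1 e k) ∈ (A m).obj k)
    (hAH : ∀ m k (x : (B.obj m).obj k) (t : (Δ[1] : SSet.{u}).obj k),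
      x ∈ (A m).obj k → (H m).app k (x, t) ∈ (A m).obj k)
    (hH : ∀ {m m' : SimplexCategoryᵒᵖ} (θ : m ⟶ m') [Epi θ.unop] (k : SimplexCategoryᵒᵖ)
      (x : (B.obj m).obj k) (t : (Δ[1] : SSet.{u}).obj k),
      (B.map θ).app k ((H m).app k (x, t)) = (H m').app k ((B.map θ).app k x, t))
    (S : (diagonal B).Subcomplex) (hS : ∀ k x, x ∈ S.obj k ↔ x ∈ (A k).obj k) :
    anodyneExtensions S.ι := by
  refine anodyneExtensions_diagonal_ι A hA (fun N => ?_) S hS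
  refine anodyneExtensions_ι_of_homotopy _ e (H _) (h₀ _) (fun k x => Or.inl (h₁ _ k x)) ?_
  rintro k x t (hx | hx)
  · exact Or.inl (hAH _ k x t hx)
  · obtain ⟨m, hm, θ, _, y, rfl⟩ := (mem_degenerate_iff (row B k) x).1 hx
    exact Or.inr ⟨m, hm, θ, (H (op ⦋m⦌)).app k (y, t), hH θ.op k y t⟩

end Diagonal

end SSet

/-! ### Nerves and levelwise full subcategories. -/

namespace CategoryTheory

open MonoidalCategory

section

variable {D E : Type u} [Category.{v} D] [Category.{v} E]

/-- Functors whose objects lie in the image of a full functor which is injective on objects lift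
along it. -/
lemma Functor.exists_comp_eq {J : Type u₁} [Category.{v₁} J] (F : D ⥤ E) [F.Full] [F.Faithful]
    (x : J ⥤ E) (hx : ∀ i, ∃ d, F.obj d = x.obj i) : ∃ z : J ⥤ D, z ⋙ F = x := by
  choose z hz using hx
  refine ⟨
    { obj := z
      map := fun {i j} f => F.preimage (eqToHom (hz i) ≫ x.map f ≫ eqToHom (hz j).symm)
      map_id := fun i => F.map_injective (by simp)
      map_comp := fun f g => F.map_injective (by simp) }, ?_⟩
  exact Functor.ext hz (fun i j f => by simp)

lemma Functor.eq_of_comp_eq {J : Type u₁} [Category.{v₁} J] (F : D ⥤ E) [F.Faithful]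
    (hF : Function.Injective F.obj) {x y : J ⥤ D} (h : x ⋙ F = y ⋙ F) : x = y := by
  refine Functor.ext (fun i => hF (Functor.congr_obj h i)) fun i j f => F.map_injective ?_
  have := Functor.congr_hom h f
  simpa [eqToHom_map] using this

/-- The simplicial homotopy between the maps induced on nerves by two functors which are connected
by a natural transformation. -/
def nerveHomotopy (η : Fin 2 ⥤ (D ⥤ E)) :
    nerve D ⊗ (Δ[1] : SSet.{max u v}) ⟶ nerve E where
  app k := ↾fun x =>
    { obj := fun i => (η.obj (SSet.stdSimplex.asOrderHom x.2 i)).obj (x.1.obj i)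
      map := fun {i j} f =>
        (η.map (homOfLE ((SSet.stdSimplex.asOrderHom x.2).monotone (leOfHom f)))).app (x.1.obj i) ≫
          (η.obj (SSet.stdSimplex.asOrderHom x.2 j)).map (x.1.map f)
      map_id := fun i => by
        rw [show homOfLE _ = 𝟙 _ from rfl, η.map_id, x.1.map_id]
        simp
      map_comp := fun {i j l} f g => by
        have : homOfLE ((SSet.stdSimplex.asOrderHom x.2).monotone (leOfHom (f ≫ g))) =
          homOfLE ((SSet.stdSimplex.asOrderHom x.2).monotone (leOfHom f)) ≫
            homOfLE ((SSet.stdSimplex.asOrderHom x.2).monotone (leOfHom g)) := rfl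
        rw [this, η.map_comp, x.1.map_comp]
        simp }
  naturality k k' f := rfl

lemma nerveHomotopy_const (η : Fin 2 ⥤ (D ⥤ E)) (a : Fin 2) (k : SimplexCategoryᵒᵖ)
    (x : (nerve D).obj k) :
    (nerveHomotopy η).app k (x, SSet.stdSimplex.const 1 a k) = (nerveMap (η.obj a)).app k x := by
  refine Functor.hext (fun _ => rfl) fun i j f => heq_of_eq ?_
  change (η.map (𝟙 a)).app _ ≫ (η.obj a).map (x.map f) = (η.obj a).map (x.map f)
  rw [η.map_id, NatTrans.id_app, Category.id_comp]

lemma nerveHomotopy_whiskeringRight (η : Fin 2 ⥤ (D ⥤ D)) (F : D ⥤ E) (k : SimplexCategoryᵒᵖ)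
    (x : (nerve D).obj k) (t : (Δ[1] : SSet.{max u v}).obj k) :
    (nerveHomotopy (η ⋙ (Functor.whiskeringRight _ _ _).obj F)).app k (x, t) =
      (nerveMap F).app k ((nerveHomotopy η).app k (x, t)) := by
  refine Functor.hext (fun _ => rfl) fun i j f => heq_of_eq ?_
  exact (F.map_comp _ _).symm

/-- The simplices of the nerve all of whose vertices have a given property. -/
def nerveSubcomplex (P : ObjectProperty D) : (nerve D).Subcomplex where
  obj _ := {x | ∀ i, P (x.obj i)}
  map _ _ hx _ := hx _

end

/-- A map of simplicial categories which is levelwise the inclusion of a full subcategory induces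
a homotopy equivalence on realizations if there are levelwise natural transformations between the
identity and a functor to the subcategory which are compatible with the degeneracies. -/
theorem isHomotopyEquiv_simplicialCatRealization_map
    {X Y : SimplexCategoryᵒᵖ ⥤ Cat.{v, u}} (α : X ⟶ Y)
    (hfull : ∀ m, (α.app m).toFunctor.Full) (hfaithful : ∀ m, (α.app m).toFunctor.Faithful)
    (hα : ∀ m, Function.Injective (α.app m).toFunctor.obj)
    (e : Fin 2) (ε : ∀ m, Fin 2 ⥤ (Y.obj m ⥤ Y.obj m))
    (h₀ : ∀ m, (ε m).obj e.rev = 𝟭 _)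
    (h₁ : ∀ m y, ∃ x, (α.app m).toFunctor.obj x = ((ε m).obj e).obj y)
    (hε : ∀ {m m' : SimplexCategoryᵒᵖ} (θ : m ⟶ m') [Epi θ.unop],
      ε m ⋙ (Functor.whiskeringRight _ _ _).obj (Y.map θ).toFunctor =
        ε m' ⋙ (Functor.whiskeringLeft _ _ _).obj (Y.map θ).toFunctor) :
    (simplicialCatRealization.map α).hom.IsHomotopyEquiv := by
  let f : SSet.diagonal (X ⋙ nerveFunctor) ⟶ SSet.diagonal (Y ⋙ nerveFunctor) :=
    Functor.whiskerLeft _ (Functor.uncurry.map (Functor.whiskerRight α nerveFunctor))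
  have hf : ∀ k x, f.app k x = x ⋙ (α.app k).toFunctor := fun _ _ => rfl
  let P : ∀ m, ObjectProperty (Y.obj m) := fun m y => ∃ x, (α.app m).toFunctor.obj x = y
  have hrev : ∀ a : Fin 2, a = e ∨ a = e.rev := by fin_cases e <;> decide
  have hP : ∀ m a y, P m y → P m (((ε m).obj a).obj y) := fun m a y hy => by
    obtain rfl | rfl := hrev a
    · exact h₁ m y
    · rw [h₀]; exact hy
  suffices SSet.anodyneExtensions f from this.isHomotopyEquiv_toTop_map
  -- Being mono, `f` is an isomorphism onto its range, so only the inclusion of the range has to be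
  -- anodyne.
  have : Mono f := by
    rw [NatTrans.mono_iff_mono_app]
    intro k
    rw [mono_iff_injective]
    intro x y hxy
    rw [hf, hf] at hxy
    have := hfaithful k
    exact Functor.eq_of_comp_eq _ (hα k) hxy
  have key : SSet.anodyneExtensions (SSet.Subcomplex.range f).ι := by
    refine SSet.anodyneExtensions_diagonal_ι_of_homotopy (B := Y ⋙ nerveFunctor)
      (fun m => nerveSubcomplex (P m)) ?_ e (fun m => nerveHomotopy (ε m)) ?_ ?_ ?_ ?_ _ ?_
    · intro m m' θ k x hx i
      obtain ⟨y, hy⟩ := hx i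
      refine ⟨(X.map θ).toFunctor.obj y, ?_⟩
      refine (Functor.congr_obj (congrArg Cat.Hom.toFunctor (α.naturality θ)) y).trans ?_
      exact congrArg (Y.map θ).toFunctor.obj hy
    · intro m k x
      refine (nerveHomotopy_const (ε m) _ k x).trans ?_
      rw [h₀]
      rfl
    · intro m k x i
      exact h₁ m _
    · intro m k x t hx i
      exact hP m _ _ (hx i)
    · intro m m' θ _ k x t
      refine (nerveHomotopy_whiskeringRight (ε m) (Y.map θ).toFunctor k x t).symm.trans ?_
      rw [hε θ]
      rfl
    · intro k x
      constructor
      · rintro ⟨z, rfl⟩ i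
        rw [hf]
        exact ⟨z.obj i, rfl⟩
      -- By fullness, a chain whose vertices lie in the subcategory lies in it entirely.
      · intro hx
        have := hfull k
        have := hfaithful k
        obtain ⟨z, hz⟩ := Functor.exists_comp_eq (α.app k).toFunctor x hx
        exact ⟨z, (hf k z).trans hz⟩
  rw [← Subfunctor.toRange_ι f]
  exact MorphismProperty.comp_mem _ _ _ (SSet.anodyneExtensions.of_isIso _) key

end CategoryTheory

/-! ### The collage of a functor. -/

namespace CategoryTheory

lemma Functor.map_heq_of_heq {D : Type u₁} [Category.{v₁} D] {E : Type u₂} [Category.{v₂} E]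
    (F : D ⥤ E) {a a' b b' : D} {f : a ⟶ b} {g : a' ⟶ b'} (ha : a = a') (hb : b = b')
    (h : HEq f g) : HEq (F.map f) (F.map g) := by
  subst ha hb
  rw [eq_of_heq h]

/-- Equality of whiskerings of natural transformations, considered as functors from `Fin 2`. -/
lemma mk₁_comp_whiskering_eq {D : Type u₁} [Category.{v₁} D] {E : Type u₂} [Category.{v₂} E]
    {E₀ E₁ : D ⥤ D} {E₀' E₁' : E ⥤ E} (ν : E₀ ⟶ E₁) (ν' : E₀' ⟶ E₁') (G : D ⥤ E)
    (h₀ : E₀ ⋙ G = G ⋙ E₀') (h₁ : E₁ ⋙ G = G ⋙ E₁')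
    (h : ∀ d, HEq (G.map (ν.app d)) (ν'.app (G.obj d))) :
    (ComposableArrows.mk₁ ν : Fin 2 ⥤ _) ⋙ (Functor.whiskeringRight _ _ _).obj G =
      (ComposableArrows.mk₁ ν' : Fin 2 ⥤ _) ⋙ (Functor.whiskeringLeft _ _ _).obj G := by
  refine ComposableArrows.ext₁ h₀ h₁ ?_
  refine NatTrans.ext (funext fun d => ?_)
  change G.map (ν.app d) = ((eqToHom h₀ : E₀ ⋙ G ⟶ G ⋙ E₀') ≫ Functor.whiskerLeft G ν' ≫
    (eqToHom h₁.symm : G ⋙ E₁' ⟶ E₁ ⋙ G)).app d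
  rw [NatTrans.comp_app, NatTrans.comp_app, eqToHom_app, eqToHom_app]
  exact (conj_eqToHom_iff_heq' _ _ _ _).2 (h d)

section Collage

variable {T S : Type u} [𝓣 : Category.{v} T] [𝓢 : Category.{v} S]

/-- The objects of the collage of a functor `U : T ⥤ S`: the disjoint union of those of `T`
and `S`. -/
inductive Collage (U : T ⥤ S) : Type u where
  | left (t : T)
  | right (s : S)

namespace Collage

/-- The morphisms of the collage: those of `T` and `S`, and the morphisms from `U t` to `s` as
additional morphisms from `t` to `s`. -/
def Hom {U : T ⥤ S} (x y : Collage U) : Type v :=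
  match x, y with
  | left t, left t' => t ⟶ t'
  | left t, right s => U.obj t ⟶ s
  | right s, right s' => s ⟶ s'
  | right _, left _ => PEmpty.{v + 1}

instance (U : T ⥤ S) : Category.{v} (Collage U) where
  Hom := Hom
  id x := match x with
    | left t => 𝟙 t
    | right s => 𝟙 s
  comp {x y z} f g := match x, y, z, f, g with
    | left _, left _, left _, f, g => (f ≫ g : _ ⟶ _)
    | left _, left _, right _, f, g => (U.map f ≫ g : _ ⟶ _)
    | left _, right _, right _, f, g => (f ≫ g : _ ⟶ _)
    | right _, right _, right _, f, g => (f ≫ g : _ ⟶ _)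
    | _, right _, left _, _, g => g.elim
    | right _, left _, _, f, _ => f.elim
  id_comp {x y} f := match x, y, f with
    | left _, left _, f => 𝓣.id_comp f
    | left t, right _, f => (congrArg (· ≫ f) (U.map_id t)).trans (𝓢.id_comp f)
    | right _, right _, f => 𝓢.id_comp f
    | right _, left _, f => f.elim
  comp_id {x y} f := match x, y, f with
    | left _, left _, f => 𝓣.comp_id f
    | left _, right _, f => 𝓢.comp_id f
    | right _, right _, f => 𝓢.comp_id f
    | right _, left _, f => f.elim
  assoc {x y z w} f g h := match x, y, z, w, f, g, h with
    | left _, left _, left _, left _, f, g, h => 𝓣.assoc f g h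
    | left _, left _, left _, right _, f, g, h =>
      (congrArg (· ≫ h) (U.map_comp f g)).trans (𝓢.assoc _ _ _)
    | left _, left _, right _, right _, _, _, _ => 𝓢.assoc _ _ _
    | left _, right _, right _, right _, _, _, _ => 𝓢.assoc _ _ _
    | right _, right _, right _, right _, f, g, h => 𝓢.assoc f g h
    | right _, left _, _, _, f, _, _ => f.elim
    | _, right _, left _, _, _, g, _ => g.elim
    | _, _, right _, left _, _, _, h => h.elim

variable (U : T ⥤ S)

/-- The inclusion of the source. -/
def inl : T ⥤ Collage U where
  obj := left
  map f := f

/-- The inclusion of the target. -/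
def inr : S ⥤ Collage U where
  obj := right
  map f := f

/-- The universal morphism from `t` to `U t`. -/
def unit (t : T) : (inl U).obj t ⟶ (inr U).obj (U.obj t) := 𝟙 (U.obj t)

/-- The morphisms of the collage from `t` to `s`. -/
abbrev mixed {t : T} {s : S} (f : U.obj t ⟶ s) : (inl U).obj t ⟶ (inr U).obj s := f

lemma mixed_eq {t : T} {s : S} (f : U.obj t ⟶ s) : mixed U f = unit U t ≫ (inr U).map f :=
  (𝓢.id_comp f).symm

lemma inl_map_comp_unit {t t' : T} (f : t ⟶ t') :
    (inl U).map f ≫ unit U t' = unit U t ≫ (inr U).map (U.map f) :=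
  (𝓢.comp_id (U.map f)).trans (𝓢.id_comp (U.map f)).symm

/-- The canonical natural transformation between the two inclusions. -/
def unitNatTrans : inl U ⟶ U ⋙ inr U where
  app := unit U
  naturality _ _ f := inl_map_comp_unit U f

instance : (inl U).Full := ⟨fun f => ⟨f, rfl⟩⟩

instance : (inl U).Faithful := ⟨fun h => h⟩

instance : (inr U).Full := ⟨fun f => ⟨f, rfl⟩⟩

instance : (inr U).Faithful := ⟨fun h => h⟩

lemma inl_obj_injective : Function.Injective (inl U).obj := fun _ _ h => left.inj h

lemma inr_obj_injective : Function.Injective (inr U).obj := fun _ _ h => right.inj h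

variable {U}

-- A morphism from `T` to `S` factors as `unit` followed by a morphism of `S`. Naturality and
-- equality therefore reduce to `T`, `S` and the morphisms `unit`.
@[elab_as_elim]
lemma hom_induction {P : ∀ {x y : Collage U}, (x ⟶ y) → Prop}
    (hl : ∀ {t t'} (f : t ⟶ t'), P ((inl U).map f))
    (hr : ∀ {s s'} (f : s ⟶ s'), P ((inr U).map f))
    (h : ∀ {t s} (f : U.obj t ⟶ s), P (unit U t ≫ (inr U).map f))
    {x y : Collage U} (f : x ⟶ y) : P f := by
  have h' : ∀ {t s} (f : U.obj t ⟶ s), P (mixed U f) := fun f => by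
    rw [mixed_eq]
    exact h f
  match x, y, f with
  | left _, left _, f => exact hl f
  | right _, right _, f => exact hr f
  | right _, left _, f => exact f.elim
  | left t, right s, f =>
    exact h' (t := t) (s := s) f

section

variable {E : Type u₁} [Category.{v₁} E]

lemma app_comp_map_comp {G : T ⥤ E} {K : S ⥤ E} (β : G ⟶ U ⋙ K) {t t' : T} {s : S}
    (f : t ⟶ t') (g : U.obj t' ⟶ s) :
    β.app t ≫ K.map (U.map f ≫ g) = G.map f ≫ β.app t' ≫ K.map g := by
  rw [K.map_comp, ← Category.assoc, ← Category.assoc]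
  exact congrArg (· ≫ K.map g) (β.naturality f).symm

lemma comp_map_comp (K : S ⥤ E) {e : E} {s s' s'' : S} (b : e ⟶ K.obj s) (f : s ⟶ s')
    (g : s' ⟶ s'') : b ≫ K.map (f ≫ g) = (b ≫ K.map f) ≫ K.map g := by
  rw [K.map_comp, Category.assoc]

/-- Functors from the collage. -/
def desc (G : T ⥤ E) (K : S ⥤ E) (β : G ⟶ U ⋙ K) : Collage U ⥤ E where
  obj x := match x with
    | left t => G.obj t
    | right s => K.obj s
  map {x y} f := match x, y, f with
    | left _, left _, f => G.map f
    | left t, right _, f => β.app t ≫ K.map f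
    | right _, right _, f => K.map f
    | right _, left _, f => f.elim
  map_id x := match x with
    | left t => G.map_id t
    | right s => K.map_id s
  map_comp {x y z} f g := match x, y, z, f, g with
    | left _, left _, left _, f, g => G.map_comp f g
    | left _, left _, right _, f, g => app_comp_map_comp β f g
    | left _, right _, right _, f, g => comp_map_comp K _ f g
    | right _, right _, right _, f, g => K.map_comp f g
    | _, right _, left _, _, g => g.elim
    | right _, left _, _, f, _ => f.elim

lemma desc_map_unit (G : T ⥤ E) (K : S ⥤ E) (β : G ⟶ U ⋙ K) (t : T) :
    (desc G K β).map (unit U t) = β.app t :=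
  (congrArg (β.app t ≫ ·) (K.map_id _)).trans (Category.comp_id _)

lemma functor_ext {Φ Ψ : Collage U ⥤ E} (hl : inl U ⋙ Φ = inl U ⋙ Ψ)
    (hr : inr U ⋙ Φ = inr U ⋙ Ψ) (h : ∀ t, HEq (Φ.map (unit U t)) (Ψ.map (unit U t))) :
    Φ = Ψ := by
  have hobj : ∀ x, Φ.obj x = Ψ.obj x := fun x => match x with
    | left t => Functor.congr_obj hl t
    | right s => Functor.congr_obj hr s
  have hr' : ∀ {s s' : S} (f : s ⟶ s'), HEq (Φ.map ((inr U).map f)) (Ψ.map ((inr U).map f)) :=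
    fun f => Functor.hcongr_hom hr f
  refine Functor.hext hobj fun x y f => ?_
  induction f using hom_induction with
  | hl f => exact Functor.hcongr_hom hl f
  | hr f => exact hr' f
  | @h t s f =>
    rw [Φ.map_comp, Ψ.map_comp]
    have h₀ := h t
    have h₁ := hr' f
    revert h₀ h₁
    generalize Φ.map (unit U t) = a, Ψ.map (unit U t) = a', Φ.map ((inr U).map f) = b,
      Ψ.map ((inr U).map f) = b'
    revert a a' b b'
    rw [hobj, hobj, hobj]
    intro a a' b b' ha hb
    rw [eq_of_heq ha, eq_of_heq hb]

end

/-- Natural transformations between functors from the collage. -/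
def natTransMk {E : Type u₁} [Category.{v₁} E] {Φ Ψ : Collage U ⥤ E}
    (νl : inl U ⋙ Φ ⟶ inl U ⋙ Ψ) (νr : inr U ⋙ Φ ⟶ inr U ⋙ Ψ)
    (h : ∀ t, Φ.map (unit U t) ≫ νr.app (U.obj t) = νl.app t ≫ Ψ.map (unit U t)) : Φ ⟶ Ψ where
  app x := match x with
    | left t => νl.app t
    | right s => νr.app s
  naturality x y f := by
    induction f using hom_induction with
    | hl f => exact νl.naturality f
    | hr f => exact νr.naturality f
    | @h t s f =>
      rw [Φ.map_comp, Ψ.map_comp, Category.assoc]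
      refine (congrArg (Φ.map (unit U t) ≫ ·) (νr.naturality f)).trans ?_
      refine (Category.assoc _ _ _).symm.trans ?_
      exact (congrArg (· ≫ Ψ.map ((inr U).map f)) (h t)).trans (Category.assoc _ _ _)

section

variable {T' S' : Type u} [Category.{v} T'] [Category.{v} S'] {U' : T' ⥤ S'}

/-- The functoriality of the collage with respect to commutative squares of functors. -/
def map (G : T ⥤ T') (K : S ⥤ S') (h : G ⋙ U' = U ⋙ K) : Collage U ⥤ Collage U' :=
  desc (G ⋙ inl U') (K ⋙ inr U')
    (Functor.whiskerLeft G (unitNatTrans U') ≫ eqToHom (congrArg (· ⋙ inr U') h))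

/-- The functor `map` preserves the universal morphisms; the equality is heterogeneous since `h`
need not hold definitionally on targets. -/
lemma map_map_unit (G : T ⥤ T') (K : S ⥤ S') (h : G ⋙ U' = U ⋙ K) (t : T) :
    HEq ((map G K h).map (unit U t)) (unit U' (G.obj t)) := by
  rw [map, desc_map_unit, NatTrans.comp_app, eqToHom_app]
  exact comp_eqToHom_heq _ _

lemma map_id (h : 𝟭 T ⋙ U = U ⋙ 𝟭 S) : map (𝟭 T) (𝟭 S) h = 𝟭 (Collage U) :=
  functor_ext rfl rfl fun _ => map_map_unit _ _ h _

lemma map_comp {T'' S'' : Type u} [Category.{v} T''] [Category.{v} S''] {U'' : T'' ⥤ S''}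
    (G : T ⥤ T') (K : S ⥤ S') (h : G ⋙ U' = U ⋙ K)
    (G' : T' ⥤ T'') (K' : S' ⥤ S'') (h' : G' ⋙ U'' = U' ⋙ K')
    (h'' : (G ⋙ G') ⋙ U'' = U ⋙ K ⋙ K') :
    map (G ⋙ G') (K ⋙ K') h'' = map G K h ⋙ map G' K' h' := by
  refine functor_ext rfl rfl fun t => (map_map_unit _ _ h'' t).trans ?_
  refine HEq.symm (HEq.trans ?_ (map_map_unit G' K' h' (G.obj t)))
  exact Functor.map_heq_of_heq (map G' K' h') rfl
    (congrArg right (Functor.congr_obj h t).symm) (map_map_unit G K h t)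

lemma map_congr {G G' : T ⥤ T'} {K K' : S ⥤ S'} (hG : G = G') (hK : K = K')
    (h : G ⋙ U' = U ⋙ K) : map G K h = map G' K' (hG ▸ hK ▸ h) := by
  subst hG hK
  rfl

/-- The retraction of the collage onto the target. -/
def proj (U : T ⥤ S) : Collage U ⥤ S := desc U (𝟭 S) (𝟙 U)

lemma proj_map_unit (U : T ⥤ S) (t : T) : (proj U).map (unit U t) = 𝟙 (U.obj t) :=
  desc_map_unit U (𝟭 S) (𝟙 U) t

lemma map_comp_proj (G : T ⥤ T') (K : S ⥤ S') (h : G ⋙ U' = U ⋙ K) :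
    map G K h ⋙ proj U' = proj U ⋙ K := by
  refine functor_ext h rfl fun t => ?_
  refine (Functor.map_heq_of_heq (proj U') rfl ?_ (map_map_unit G K h t)).trans ?_
  · exact congrArg right (Functor.congr_obj h t).symm
  · change HEq ((proj U').map (unit U' (G.obj t))) (K.map ((proj U).map (unit U t)))
    rw [proj_map_unit, proj_map_unit]
    refine HEq.trans ?_ (heq_of_eq (K.map_id (U.obj t)).symm)
    have : U'.obj (G.obj t) = K.obj (U.obj t) := Functor.congr_obj h t
    exact congr_arg_heq (fun s => 𝟙 s) this

end

/-- The natural transformation from the identity to the reflection onto the target. -/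
def toProj (U : T ⥤ S) : 𝟭 (Collage U) ⟶ proj U ⋙ inr U :=
  natTransMk (unitNatTrans U) (𝟙 (inr U)) fun t => by
    refine (Category.comp_id _).trans ?_
    change unit U t = unit U t ≫ (inr U).map ((proj U).map (unit U t))
    rw [proj_map_unit]
    exact (Category.comp_id _).symm

section

variable (F : S ⥤ T) (τ : 𝟭 T ⟶ U ⋙ F)

/-- The coreflection of the collage onto the source defined by `F : S ⥤ T` and a natural
transformation `𝟭 T ⟶ U ⋙ F`. -/
def coproj : Collage U ⥤ T := desc (𝟭 T) F τ

/-- The canonical natural transformation from the composition of a section of `U` with the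
inclusion of the source to the inclusion of the target. -/
def unitOfSection {F : S ⥤ T} (hF : F ⋙ U = 𝟭 S) : F ⋙ inl U ⟶ inr U :=
  Functor.whiskerLeft F (unitNatTrans U) ≫ eqToHom (congrArg (· ⋙ inr U) hF)

lemma unitOfSection_app {F : S ⥤ T} (hF : F ⋙ U = 𝟭 S) (s : S) :
    (unitOfSection hF).app s =
      unit U (F.obj s) ≫ eqToHom (congrArg right (Functor.congr_obj hF s)) := by
  rw [unitOfSection, NatTrans.comp_app, eqToHom_app]
  rfl

/-- The natural transformation from the coreflection onto the source to the identity. -/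
def ofCoproj (hF : F ⋙ U = 𝟭 S)
    (hτ : ∀ t, U.map (τ.app t) = eqToHom (Functor.congr_obj hF (U.obj t)).symm) :
    coproj F τ ⋙ inl U ⟶ 𝟭 (Collage U) :=
  natTransMk (𝟙 (inl U)) (unitOfSection hF) fun t => by
    refine Eq.trans ?_ (Category.id_comp _).symm
    refine (congrArg (_ ≫ ·) (unitOfSection_app hF (U.obj t))).trans ?_
    refine (congrArg ((inl U).map · ≫ _) (desc_map_unit (𝟭 T) F τ t)).trans ?_
    refine (Category.assoc _ _ _).symm.trans ?_
    -- Naturality along `unit` holds because `τ` lies over the identity of `S`, up to the transport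
    -- in `hτ`.
    have h₁ : (inl U).map (τ.app t) ≫ unit U (F.obj (U.obj t)) =
      unit U t ≫ (inr U).map (eqToHom (Functor.congr_obj hF (U.obj t)).symm) :=
      (inl_map_comp_unit U (τ.app t)).trans (congrArg (unit U t ≫ (inr U).map ·) (hτ t))
    refine (congrArg (· ≫ eqToHom _) h₁).trans ?_
    rw [eqToHom_map, Category.assoc]
    exact (congrArg (unit U t ≫ ·) (eqToHom_trans _ _)).trans (Category.comp_id _)

lemma ofCoproj_app_right_heq (hF : F ⋙ U = 𝟭 S)
    (hτ : ∀ t, U.map (τ.app t) = eqToHom (Functor.congr_obj hF (U.obj t)).symm) (s : S) :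
    HEq ((ofCoproj F τ hF hτ).app (right s)) (unit U (F.obj s)) := by
  change HEq ((unitOfSection hF).app s) _
  rw [unitOfSection_app]
  exact comp_eqToHom_heq _ _

end

end Collage

end Collage

end CategoryTheory

/-! ### Simplicial collages and the resulting criterion. -/

namespace CategoryTheory

section

variable {T S : SimplexCategoryᵒᵖ ⥤ Cat.{v, u}} (U : T ⟶ S)

lemma toFunctor_naturality {m m' : SimplexCategoryᵒᵖ} (θ : m ⟶ m') :
    (T.map θ).toFunctor ⋙ (U.app m').toFunctor = (U.app m).toFunctor ⋙ (S.map θ).toFunctor :=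
  congrArg Cat.Hom.toFunctor (U.naturality θ)

/-- The levelwise collage of a map of simplicial categories. -/
def simplicialCollage : SimplexCategoryᵒᵖ ⥤ Cat.{v, u} where
  obj m := Cat.of (Collage (U.app m).toFunctor)
  map θ := (Collage.map (T.map θ).toFunctor (S.map θ).toFunctor
    (toFunctor_naturality U θ)).toCatHom
  map_id m := Cat.ext ((Collage.map_congr (congrArg Cat.Hom.toFunctor (T.map_id m))
    (congrArg Cat.Hom.toFunctor (S.map_id m)) (toFunctor_naturality U (𝟙 m))).trans
      (Collage.map_id (U := (U.app m).toFunctor) rfl))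
  map_comp θ θ' := Cat.ext ((Collage.map_congr (congrArg Cat.Hom.toFunctor (T.map_comp θ θ'))
    (congrArg Cat.Hom.toFunctor (S.map_comp θ θ')) (toFunctor_naturality U (θ ≫ θ'))).trans
      (Collage.map_comp _ _ (toFunctor_naturality U θ) _ _ (toFunctor_naturality U θ') _))

namespace simplicialCollage

/-- The inclusion of the source. -/
def inl : T ⟶ simplicialCollage U where
  app m := (Collage.inl (U.app m).toFunctor).toCatHom
  naturality _ _ _ := rfl

/-- The inclusion of the target. -/
def inr : S ⟶ simplicialCollage U where
  app m := (Collage.inr (U.app m).toFunctor).toCatHom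
  naturality _ _ _ := rfl

/-- The retraction onto the target. -/
def proj : simplicialCollage U ⟶ S where
  app m := (Collage.proj (U.app m).toFunctor).toCatHom
  naturality _ _ θ := Cat.ext (Collage.map_comp_proj _ _ (toFunctor_naturality U θ))

lemma inl_proj : inl U ≫ proj U = U := rfl

lemma inr_proj : inr U ≫ proj U = 𝟙 S := rfl

/-- The reflection `𝟭 ⟶ proj ⋙ inr` is made of universal morphisms and identities, hence compatible
with every simplicial operator. Its target is the end lying in `S`, whence `e = 1`. -/
lemma isHomotopyEquiv_inr : (simplicialCatRealization.map (inr U)).hom.IsHomotopyEquiv := by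
  refine isHomotopyEquiv_simplicialCatRealization_map (inr U)
    (fun m => inferInstanceAs (Collage.inr (U.app m).toFunctor).Full)
    (fun m => inferInstanceAs (Collage.inr (U.app m).toFunctor).Faithful)
    (fun m => Collage.inr_obj_injective _) 1
    (fun m => (ComposableArrows.mk₁ (Collage.toProj (U.app m).toFunctor) : Fin 2 ⥤ _))
    (fun m => rfl) (fun m y => ⟨_, rfl⟩) fun {m m'} θ _ => ?_
  refine mk₁_comp_whiskering_eq _ _ _ rfl ?_ ?_
  · exact congrArg (· ⋙ Collage.inr (U.app m').toFunctor)
      (Collage.map_comp_proj _ _ (toFunctor_naturality U θ)).symm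
  · rintro (t | s)
    · exact Collage.map_map_unit _ _ (toFunctor_naturality U θ) t
    · exact heq_of_eq (Functor.map_id _ _)

lemma isHomotopyEquiv_proj : (simplicialCatRealization.map (proj U)).hom.IsHomotopyEquiv := by
  refine (isHomotopyEquiv_inr U).of_comp_eq_id ?_
  have := simplicialCatRealization.map_comp (inr U) (proj U)
  rw [inr_proj, Functor.map_id] at this
  exact congrArg TopCat.Hom.hom this.symm

variable (F : ∀ m, S.obj m ⥤ T.obj m) (hF : ∀ m, F m ⋙ (U.app m).toFunctor = 𝟭 _)
  (τ : ∀ m, 𝟭 (T.obj m) ⟶ (U.app m).toFunctor ⋙ F m)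
  (hτ : ∀ m t, (U.app m).toFunctor.map ((τ m).app t) =
    eqToHom (Functor.congr_obj (hF m) ((U.app m).toFunctor.obj t)).symm)
  (hFθ : ∀ {m m' : SimplexCategoryᵒᵖ} (θ : m ⟶ m') [Epi θ.unop],
    F m ⋙ (T.map θ).toFunctor = (S.map θ).toFunctor ⋙ F m')
  (hτθ : ∀ {m m' : SimplexCategoryᵒᵖ} (θ : m ⟶ m') [Epi θ.unop] (t : T.obj m),
    HEq ((T.map θ).toFunctor.map ((τ m).app t)) ((τ m').app ((T.map θ).toFunctor.obj t)))

include hF τ hτ hFθ hτθ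

/-- Here the deformation `coproj ⋙ inl ⟶ 𝟭` starts in `T`, whence `e = 0`. It is built from `F` and
`τ`, and is therefore compatible only with the operators for which they are. -/
lemma isHomotopyEquiv_inl : (simplicialCatRealization.map (inl U)).hom.IsHomotopyEquiv := by
  refine isHomotopyEquiv_simplicialCatRealization_map (inl U)
    (fun m => inferInstanceAs (Collage.inl (U.app m).toFunctor).Full)
    (fun m => inferInstanceAs (Collage.inl (U.app m).toFunctor).Faithful)
    (fun m => Collage.inl_obj_injective _) 0
    (fun m => (ComposableArrows.mk₁ (Collage.ofCoproj (F m) (τ m) (hF m) (hτ m)) : Fin 2 ⥤ _))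
    (fun m => rfl) (fun m y => ⟨_, rfl⟩) fun {m m'} θ _ => ?_
  have hn := toFunctor_naturality U θ
  have hu : ∀ t, HEq ((Collage.map _ _ hn).map (Collage.unit (U.app m).toFunctor t))
    (Collage.unit (U.app m').toFunctor ((T.map θ).toFunctor.obj t)) := Collage.map_map_unit _ _ hn
  refine mk₁_comp_whiskering_eq _ _ _ ?_ rfl ?_
  · refine congrArg (· ⋙ Collage.inl (U.app m').toFunctor)
      (?_ : Collage.coproj (F m) (τ m) ⋙ (T.map θ).toFunctor =
        Collage.map _ _ hn ⋙ Collage.coproj (F m') (τ m'))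
    refine Collage.functor_ext rfl (hFθ θ) fun t => ?_
    have h₁ : HEq ((T.map θ).toFunctor.map
        ((Collage.coproj (F m) (τ m)).map (Collage.unit (U.app m).toFunctor t)))
        ((τ m').app ((T.map θ).toFunctor.obj t)) :=
      (heq_of_eq (congrArg (T.map θ).toFunctor.map
        (Collage.desc_map_unit (𝟭 _) (F m) (τ m) t))).trans (hτθ θ t)
    refine h₁.trans ?_
    refine HEq.symm ((Functor.map_heq_of_heq (Collage.coproj (F m') (τ m')) rfl ?_ (hu t)).trans ?_)
    · exact congrArg Collage.right (Functor.congr_obj hn t).symm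
    · exact heq_of_eq (Collage.desc_map_unit (𝟭 _) (F m') (τ m') _)
  · rintro (t | s)
    · exact heq_of_eq (Functor.map_id _ _)
    · refine HEq.trans ?_ (Collage.ofCoproj_app_right_heq (F m') (τ m') (hF m') (hτ m')
        ((S.map θ).toFunctor.obj s)).symm
      refine (Functor.map_heq_of_heq (Collage.map _ _ hn) rfl ?_
        (Collage.ofCoproj_app_right_heq (F m) (τ m) (hF m) (hτ m) s)).trans ?_
      · exact congrArg Collage.right (Functor.congr_obj (hF m) s).symm
      · refine (hu _).trans ?_
        exact congr_arg_heq (Collage.unit (U.app m').toFunctor) (Functor.congr_obj (hFθ θ) s)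

/-- A map of simplicial categories which levelwise has a section `F` and natural transformations
`𝟭 ⟶ U ⋙ F` over the target, all compatible with degeneracies (but not necessarily with faces),
induces a homotopy equivalence on realizations. -/
theorem isHomotopyEquiv : (simplicialCatRealization.map U).hom.IsHomotopyEquiv := by
  have := (isHomotopyEquiv_proj U).comp (isHomotopyEquiv_inl U F hF τ hτ hFθ hτθ)
  rw [← TopCat.hom_comp, ← Functor.map_comp, inl_proj] at this
  exact this

end simplicialCollage

end

end CategoryTheory

/-! ### Staircases: compatibility of `F` and `τ` with degeneracies. -/

/-- The map of rows underlying `shapeCollapse`. -/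
def collapseRow (n : ℕ) : WithBot (Fin (n + 1)) →o Fin (n + 1) where
  toFun i := i.unbotD 0
  monotone' a b h := by
    cases a with
    | bot => exact Fin.zero_le _
    | coe a =>
      cases b with
      | bot => exact absurd h (WithBot.not_coe_le_bot a)
      | coe b => exact WithBot.coe_le_coe.1 h

/-- On the row `⊥` one side gives row `0` and the other row `θ 0`; this is where `h` is needed. -/
lemma tPlusShapeMap_comp_shapeCollapse {m n : ℕ} (θ : Fin (m + 1) →o Fin (n + 1)) (h : θ 0 = 0) :
    (tPlusShapeMap θ).comp (shapeCollapse n) = (shapeCollapse m).comp (sShapeMap θ) :=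
  gridMap_congr (r := (collapseRow n).comp θ.withBotMap) (r' := θ.comp (collapseRow m)) (c := θ)
    (fun _ => le_rfl) (OrderHom.ext _ _ (funext fun x => by
      cases x with
      | bot => exact h.symm
      | coe x => rfl))

lemma shapeIncl_shapeCollapse_obj {m n : ℕ} (θ : Fin (m + 1) →o Fin (n + 1)) (h : θ 0 = 0)
    (p : (tPlusShape m).Obj) :
    (shapeIncl n).obj ((shapeCollapse n).obj ((tPlusShapeMap θ).obj p)) =
      (tPlusShapeMap θ).obj ((shapeIncl m).obj ((shapeCollapse m).obj p)) :=
  congrArg (fun K => (shapeIncl n).obj (DoubleFunctor.obj K p))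
    (tPlusShapeMap_comp_shapeCollapse θ h)

/-- In a grid, vertical morphisms are determined by their source and target. -/
lemma DoubleFunctor.vmap_heq_of_gridShape {R J : Type} [PartialOrder R] [PartialOrder J] {d : J → R}
    {D : FlatDoubleCategory.{u, v}} (X : DoubleFunctor (gridShape R J d) D)
    {p q q' : (gridShape R J d).Obj} (h : q = q') (a : (gridShape R J d).ver.Hom p q)
    (b : (gridShape R J d).ver.Hom p q') : HEq (X.vmap a) (X.vmap b) := by
  subst h
  exact heq_of_eq (congrArg X.vmap
    (@Subsingleton.elim (PLift (p.1.1 ≤ q.1.1 ∧ p.1.2 = q.1.2)) _ a b))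

namespace SquaresCategory

variable (C : SquaresCategory.{u, v})

lemma F_comp_U (n : ℕ) : C.F n ⋙ C.U n = 𝟭 (C.SCat n) := rfl

/-- The natural transformation given by the vertical morphisms from the top row to the row `0`. -/
def toFU (n : ℕ) : 𝟭 (C.TPlusCat n) ⟶ C.U n ⋙ C.F n where
  app X := ObjectProperty.homMk
    { app := fun p => X.obj.vmap (collapseHom p)
      square := fun _ => X.obj.map_square trivial
      naturality := fun a => (X.obj.vmap_comp a _).symm.trans (X.obj.vmap_comp (collapseHom _) _) }
  naturality X Y s := by
    refine ObjectProperty.hom_ext _ (DoubleFunctor.VertTrans.ext (funext fun p => ?_))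
    exact (s.hom.naturality (collapseHom p)).symm

lemma U_map_toFU_app (n : ℕ) (X : C.TPlusCat n) : (C.U n).map ((C.toFU n).app X) = 𝟙 _ := by
  refine ObjectProperty.hom_ext _ (DoubleFunctor.VertTrans.ext (funext fun p => ?_))
  exact X.obj.vmap_id _

lemma F_comp_tPlusMap {m n : ℕ} (θ : Fin (m + 1) →o Fin (n + 1)) (h : θ 0 = 0) :
    C.F n ⋙ C.tPlusMap θ = C.sMap θ ⋙ C.F m := by
  -- Stated for arbitrary shape maps, so that their equality can be substituted without transporting
  -- the proofs about diagonal values.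
  have key : ∀ (K K' : DoubleFunctor (tPlusShape m) (sShape n)) (hK : K = K')
      (h₁ : ∀ X : C.SCat n, C.tPlusProp m (K.comp X.obj))
      (h₂ : ∀ X : C.SCat n, C.tPlusProp m (K'.comp X.obj)),
      (C.tPlusProp m).lift ((C.sProp n).ι ⋙ K.precomp C.toFlatDoubleCategory) h₁ =
        (C.tPlusProp m).lift ((C.sProp n).ι ⋙ K'.precomp C.toFlatDoubleCategory) h₂ := by
    rintro K _ rfl _ _
    rfl
  exact key _ _ (tPlusShapeMap_comp_shapeCollapse θ h)
    (fun X => ((C.F n ⋙ C.tPlusMap θ).obj X).property)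
    (fun X => ((C.sMap θ ⋙ C.F m).obj X).property)

/-- At each position both components are images under `X` of vertical morphisms of the grid with the
same source and equal targets, and the grid has at most one such morphism. -/
lemma tPlusMap_map_toFU_app_heq {m n : ℕ} (θ : Fin (m + 1) →o Fin (n + 1)) (h : θ 0 = 0)
    (X : C.TPlusCat n) :
    HEq ((C.tPlusMap θ).map ((C.toFU n).app X)) ((C.toFU m).app ((C.tPlusMap θ).obj X)) := by
  have key : ∀ {Y Z Z' : C.TPlusCat m} (f : Y ⟶ Z) (g : Y ⟶ Z') (_ : Z = Z')
      (_ : ∀ p, HEq (f.hom.app p) (g.hom.app p)), HEq f g := by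
    rintro Y Z _ f g rfl hfg
    exact heq_of_eq (ObjectProperty.hom_ext _
      (DoubleFunctor.VertTrans.ext (funext fun p => eq_of_heq (hfg p))))
  refine key _ _ (Functor.congr_obj (C.F_comp_tPlusMap θ h) ((C.U n).obj X)) fun p => ?_
  exact DoubleFunctor.vmap_heq_of_gridShape X.obj (shapeIncl_shapeCollapse_obj θ h p)
    (collapseHom _) ((tPlusShapeMap θ).vmap (collapseHom p))

end SquaresCategory

/-- Some `x` maps to `0` by surjectivity, and `0 ≤ x`. So the results for `θ 0 = 0` apply to all
degeneracies. -/
lemma SimplexCategory.toOrderHom_zero_of_epi {m n : SimplexCategory} (θ : m ⟶ n) [Epi θ] :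
    θ.toOrderHom 0 = 0 := by
  obtain ⟨x, hx⟩ := SimplexCategory.epi_iff_surjective.1 ‹Epi θ› 0
  exact le_antisymm ((θ.toOrderHom.monotone (Fin.zero_le x)).trans_eq hx) (Fin.zero_le _)

theorem mainTheorem4 (C : SquaresCategory.{u, v}) :
    (∃ e : ContinuousMap.HomotopyEquiv (simplicialCatRealization.obj C.TPlus)
        (simplicialCatRealization.obj C.S),
      e.toFun = (simplicialCatRealization.map C.forgetTopRow).hom) ∧
    ∀ n : ℕ, C.F n ⋙ C.U n = 𝟭 (C.SCat n) ∧
      ∃ τ : 𝟭 (C.TPlusCat n) ⟶ C.U n ⋙ C.F n,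
        ∀ (X : C.TPlusCat n) (p : (tPlusShape n).Obj),
          (τ.app X).hom.app p = X.obj.vmap (collapseHom p) := by
  refine ⟨?_, fun n => ⟨C.F_comp_U n, C.toFU n, fun _ _ => rfl⟩⟩
  exact simplicialCollage.isHomotopyEquiv C.forgetTopRow (fun m => C.F m.unop.len)
    (fun m => C.F_comp_U m.unop.len) (fun m => C.toFU m.unop.len)
    -- Since `F ⋙ U = 𝟭` holds definitionally, the `eqToHom` required here is an identity.
    (fun m X => C.U_map_toFU_app m.unop.len X)
    (fun θ _ => C.F_comp_tPlusMap θ.unop.toOrderHom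
      (SimplexCategory.toOrderHom_zero_of_epi θ.unop))
    (fun θ _ X => C.tPlusMap_map_toFU_app_heq θ.unop.toOrderHom
      (SimplexCategory.toOrderHom_zero_of_epi θ.unop) X)
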